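/- Let $A_1,A_2,A_3>0$, let $E=\{x\in\mathbb R^3 : A_1x_1^2+A_2x_2^2+A_3x_3^2\le 1\}$, let $\vec\Omega\in\mathbb R^3$ and put $\omega=\|\vec\Omega\|$. Let $\mathcal V=L^2(E,dx;\mathbb C^3)$ be the Hilbert space of square-integrable complex vector fields on $E$, let $\mathcal V^0\subset\mathcal V$ be the closed subspace of the fields orthogonal to all gradients of functions smooth on $E$ up to the boundary, and let $\Pi:\mathcal V\to\mathcal V^0$ be the orthogonal projection. The Poincaré operator is the bounded operator on $\mathcal V^0$ given by $Pv=i\,\Pi(\vec\Omega\wedge v)$. For $n\in\mathbb N$ let $\mathcal V_n\subset\mathcal V$ be the space of the vector fields whose coefficients are complex polynomials of degree at most $n$, and let $\mathcal V_n^0=\mathcal V_n\cap\mathcal V^0$. Then: 1. $\mathcal V_n^0$ is exactly the set of the fields $v\in\mathcal V_n$ that are divergence-free and tangent to $\partial E$. 2. Each space $\mathcal V_n^0$ is invariant under $P$. 3. The spectrum of $P$ is the interval $[-\omega,\omega]$, and it is pure point (the eigenvectors of $P$ span a dense subspace of $\mathcal V^0$). 4. There is an orthonormal basis of $\mathcal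 V^0$ consisting of eigenvectors of $P$ with polynomial coefficients. -/

import Mathlib

open MeasureTheory
open scoped ENNReal ContDiff

noncomputable section

namespace Poincare

/-- Euclidean space `ℝ³`. -/
abbrev R3 : Type := EuclideanSpace ℝ (Fin 3)

/-- The Hermitian space `ℂ³`, in which the vector fields take their values. -/
abbrev C3 : Type := EuclideanSpace ℂ (Fin 3)

/-- The solid ellipsoid `A₁ x₁² + A₂ x₂² + A₃ x₃² ≤ 1`. -/
def ellipsoid (A : Fin 3 → ℝ) : Set R3 := {x | ∑ i, A i * x i ^ 2 ≤ 1}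

/-- Lebesgue measure on the ellipsoid. -/
def ellipsoidMeasure (A : Fin 3 → ℝ) : Measure R3 := volume.restrict (ellipsoid A)

/-- The Hilbert space of complex vector fields on the ellipsoid with `L²` coefficients. -/
abbrev L2Fields (A : Fin 3 → ℝ) : Type := Lp C3 2 (ellipsoidMeasure A)

/-- The gradient of a complex valued function on `ℝ³`. -/
def gradField (φ : R3 → ℂ) (x : R3) : C3 :=
  WithLp.toLp 2 fun i => fderiv ℝ φ x (EuclideanSpace.single i 1)

/-- The fields (modulo a.e. equality) that are gradients of functions smooth up to the boundary
of the ellipsoid. -/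
def smoothGradients (A : Fin 3 → ℝ) : Set (L2Fields A) :=
  {f | ∃ φ : R3 → ℂ, ContDiff ℝ ∞ φ ∧ ⇑f =ᵐ[ellipsoidMeasure A] gradField φ}

/-- The closed subspace `𝒱⁰` of the fields that are orthogonal to all gradients of smooth
functions. -/
def solenoidal (A : Fin 3 → ℝ) : Submodule ℂ (L2Fields A) :=
  (Submodule.span ℂ (smoothGradients A))ᗮ

instance (A : Fin 3 → ℝ) : CompleteSpace (solenoidal A) :=
  inferInstanceAs (CompleteSpace (Submodule.span ℂ (smoothGradients A))ᗮ)

/-- The vector field on `ℝ³` whose coefficients are the polynomials `p 0, p 1, p 2`. -/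
def polyField (p : Fin 3 → MvPolynomial (Fin 3) ℂ) (x : R3) : C3 :=
  WithLp.toLp 2 fun i => MvPolynomial.eval (fun j => (x j : ℂ)) (p i)

/-- The space `𝒱ₙ` of the vector fields on the ellipsoid whose coefficients are polynomials of
degree at most `n`. -/
def polyFields (A : Fin 3 → ℝ) (n : ℕ) : Submodule ℂ (L2Fields A) where
  carrier := {f | ∃ p : Fin 3 → MvPolynomial (Fin 3) ℂ,
    (∀ i, (p i).totalDegree ≤ n) ∧ ⇑f =ᵐ[ellipsoidMeasure A] polyField p}
  zero_mem' := by
    refine ⟨0, fun i => by simp, ?_⟩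
    filter_upwards [Lp.coeFn_zero C3 2 (ellipsoidMeasure A)] with x hx
    rw [hx]
    ext i
    simp [polyField]
  add_mem' := by
    rintro f g ⟨p, hp, hf⟩ ⟨q, hq, hg⟩
    refine ⟨p + q, fun i => (MvPolynomial.totalDegree_add _ _).trans (max_le (hp i) (hq i)), ?_⟩
    filter_upwards [Lp.coeFn_add f g, hf, hg] with x hx hfx hgx
    rw [hx, Pi.add_apply, hfx, hgx]
    ext i
    simp [polyField]
  smul_mem' := by
    rintro c f ⟨p, hp, hf⟩
    refine ⟨c • p, fun i => (MvPolynomial.totalDegree_smul_le _ _).trans (hp i), ?_⟩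
    filter_upwards [Lp.coeFn_smul c f, hf] with x hx hfx
    rw [hx, Pi.smul_apply, hfx]
    ext i
    simp [polyField]

/-- The space `𝒱ₙ⁰ = 𝒱ₙ ∩ 𝒱⁰`. -/
def polySolenoidal (A : Fin 3 → ℝ) (n : ℕ) : Submodule ℂ (L2Fields A) :=
  polyFields A n ⊓ solenoidal A

/-- A polynomial vector field has zero divergence. -/
def DivFree (p : Fin 3 → MvPolynomial (Fin 3) ℂ) : Prop :=
  ∑ i, MvPolynomial.pderiv i (p i) = 0

/-- A polynomial vector field is tangent to the boundary of the ellipsoid: it is orthogonal to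
the normal direction `(A₁ x₁, A₂ x₂, A₃ x₃)` at each boundary point `x`. -/
def TangentToBoundary (A : Fin 3 → ℝ) (p : Fin 3 → MvPolynomial (Fin 3) ℂ) : Prop :=
  ∀ x : R3, ∑ i, A i * x i ^ 2 = 1 → ∑ i, ((A i * x i : ℝ) : ℂ) * polyField p x i = 0

/-- The linear map `v ↦ Ω ∧ v` of `ℂ³`, for `Ω ∈ ℝ³`. -/
def crossMap (Ω : R3) : C3 →L[ℂ] C3 :=
  LinearMap.toContinuousLinearMap
    ((WithLp.linearEquiv 2 ℂ (Fin 3 → ℂ)).symm.toLinearMap ∘ₗ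
      crossProduct (fun i => (Ω i : ℂ)) ∘ₗ (WithLp.linearEquiv 2 ℂ (Fin 3 → ℂ)).toLinearMap)

/-- The operator `u ↦ Ω ∧ u` on vector fields. -/
def crossOp (A : Fin 3 → ℝ) (Ω : R3) : L2Fields A →L[ℂ] L2Fields A :=
  (crossMap Ω).compLpL 2 (ellipsoidMeasure A)

/-- The Leray projector: the orthogonal projection `Π` onto `𝒱⁰`. -/
def leray (A : Fin 3 → ℝ) : L2Fields A →L[ℂ] solenoidal A :=
  (solenoidal A).orthogonalProjectionOnto

/-- The Poincaré operator `P v = i Π (Ω ∧ v)` on `𝒱⁰` (where `Π v = v`). -/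
def poincareOp (A : Fin 3 → ℝ) (Ω : R3) : solenoidal A →L[ℂ] solenoidal A :=
  Complex.I • (leray A ∘L crossOp A Ω ∘L (solenoidal A).subtypeL)

/-- A bounded operator on a Hilbert space has pure point spectrum: its eigenvectors span a dense
subspace. -/
def HasPurePointSpectrum {H : Type*} [NormedAddCommGroup H] [InnerProductSpace ℂ H]
    (T : H →L[ℂ] H) : Prop :=
  (⨆ μ : ℂ, Module.End.eigenspace (T : H →ₗ[ℂ] H) μ).topologicalClosure = ⊤

end Poincare

end

/-!
The heart of the matter is that the orthogonal projection `Π` maps polynomial fields of degree `n`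
to polynomial fields of degree `n`. Let `w` be such a field and let `∇φ` be its projection on the
finite dimensional space of the gradients of the polynomials of degree at most `n + 1`. The field
`p = w - ∇φ` has degree at most `n` and is orthogonal to those gradients. Testing against the
gradient of `(1 - quad A) div p`, a polynomial of degree at most `n + 1` which vanishes on the
boundary, gives `div p = 0`; testing against the gradient of the normal component
`f = ∑ Aᵢ xᵢ pᵢ`, again of degree at most `n + 1`, shows that the boundary integral of `|f|²` is
zero, so that `p` is tangent to the boundary (`OrthogonalToPolyGrads.divFree`,
`OrthogonalToPolyGrads.tangentToBoundary`). By the divergence theorem `p` is then orthogonal to all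
gradients, and `Π w = p` (`leray_mem_polySolenoidal`). This describes `𝒱ₙ⁰` and shows its
invariance by `P`.

No surface measure is needed. The divergence theorem is used only for fields tangent to the
boundary, where it has no boundary term and follows from a cutoff
(`setIntegral_divergence_eq_zero`). The boundary integral of a function `F` is written as
`∫ (3 F + x · ∇F)` over the ellipsoid, the derivative of the integral of `F` over the dilated
ellipsoids; it is positive if `F ≥ 0` does not vanish on the boundary
(`eq_zero_of_boundary_integral_eq_zero`).

Polynomial fields are dense in `L²` by the Stone-Weierstrass theorem, hence so are their
projections in `𝒱⁰`. The operator `P` is selfadjoint and preserves the increasing sequence of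
finite dimensional spaces `𝒱ₙ⁰`, whose union is dense: diagonalising it in the orthogonal
complement of each space in the next one gives the orthonormal basis
(`exists_hilbertBasis_eigenvectors`), and so the pure point spectrum.

The spectrum is contained in `[-ω, ω]` as `P` is selfadjoint of norm at most `ω = ‖Ω‖`. Conversely,
for `r ∈ [-ω, ω]` there is a unit vector `ξ` with `Ω · ξ = r`. If `a` is orthogonal to `ξ` with
`ξ ∧ a = -i a`, then `i Ω ∧ a - r a` is parallel to `ξ`, so that the plane wave
`exp (i t ξ · x) a` solves the eigenvalue equation up to a gradient. The divergence free fields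
`curl ((1 - quad A) exp (i t ξ · x) a) / t`, tangent to the boundary, are then approximate
eigenvectors as `t → ∞`, and `r` is in the spectrum (`mem_spectrum_poincareOp`).
-/

noncomputable section

namespace Poincare

open scoped InnerProductSpace ComplexConjugate Matrix Pointwise

/-! ### The divergence theorem on the ellipsoid -/

/-- The quadratic form `A₁ x₁² + A₂ x₂² + A₃ x₃²`. -/
def quad (A : Fin 3 → ℝ) (x : R3) : ℝ := ∑ i, A i * x i ^ 2

/-- The partial derivative of a complex function on `ℝ³`. -/
def partialDeriv (i : Fin 3) (f : R3 → ℂ) (x : R3) : ℂ :=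
  fderiv ℝ f x (EuclideanSpace.single i 1)

/-- The divergence of a complex vector field on `ℝ³`, given by its three coefficients. -/
def divergence (V : Fin 3 → R3 → ℂ) (x : R3) : ℂ := ∑ i, partialDeriv i (V i) x

theorem contDiff_coord {n : WithTop ℕ∞} (i : Fin 3) : ContDiff ℝ n fun x : R3 => x i :=
  (EuclideanSpace.proj (𝕜 := ℝ) i).contDiff

theorem contDiff_quad (A : Fin 3 → ℝ) {n : WithTop ℕ∞} : ContDiff ℝ n (quad A) :=
  ContDiff.sum fun i _ => contDiff_const.mul ((contDiff_coord i).pow 2)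

theorem continuous_quad (A : Fin 3 → ℝ) : Continuous (quad A) :=
  (contDiff_quad A (n := 1)).continuous

theorem hasFDerivAt_coord (i : Fin 3) (x : R3) :
    HasFDerivAt (fun x : R3 => x i) (EuclideanSpace.proj (𝕜 := ℝ) i) x :=
  (EuclideanSpace.proj (𝕜 := ℝ) i).hasFDerivAt

theorem hasFDerivAt_quad (A : Fin 3 → ℝ) (x : R3) :
    HasFDerivAt (quad A) (∑ i, (2 * (A i * x i)) • EuclideanSpace.proj (𝕜 := ℝ) i) x := by
  have h : ∀ i : Fin 3, HasFDerivAt (fun x : R3 => A i * x i ^ 2)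
      ((2 * (A i * x i)) • EuclideanSpace.proj (𝕜 := ℝ) i) x := by
    intro i
    have := (((hasFDerivAt_coord i x).pow 2).const_mul (A i))
    refine this.congr_fderiv ?_
    ext v
    simp
    ring
  have := HasFDerivAt.fun_sum (u := Finset.univ) fun i _ => h i
  exact this

theorem fderiv_quad_single (A : Fin 3 → ℝ) (x : R3) (i : Fin 3) :
    fderiv ℝ (quad A) x (EuclideanSpace.single i 1) = 2 * (A i * x i) := by
  rw [(hasFDerivAt_quad A x).fderiv]
  simp

theorem quad_smul (A : Fin 3 → ℝ) (s : ℝ) (x : R3) : quad A (s • x) = s ^ 2 * quad A x := by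
  simp only [quad, PiLp.smul_apply, smul_eq_mul, Finset.mul_sum]
  exact Finset.sum_congr rfl fun i _ => by ring

theorem mem_ellipsoid {A : Fin 3 → ℝ} {x : R3} : x ∈ ellipsoid A ↔ quad A x ≤ 1 := Iff.rfl

theorem isClosed_ellipsoid (A : Fin 3 → ℝ) : IsClosed (ellipsoid A) :=
  isClosed_le (continuous_quad A) continuous_const

theorem measurableSet_ellipsoid (A : Fin 3 → ℝ) : MeasurableSet (ellipsoid A) :=
  (isClosed_ellipsoid A).measurableSet

theorem exists_norm_le_of_quad_le {A : Fin 3 → ℝ} (hA : ∀ i, 0 < A i) (r : ℝ) :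
    ∃ R : ℝ, 0 < R ∧ ∀ x, quad A x ≤ r → ‖x‖ ≤ R := by
  refine ⟨1 + ∑ i, |r| / A i, ?_, fun x hx => ?_⟩
  · have : 0 ≤ ∑ i, |r| / A i := Finset.sum_nonneg fun i _ => by have := hA i; positivity
    linarith
  have h1 : ∀ i, x i ^ 2 ≤ |r| / A i := by
    intro i
    rw [le_div_iff₀ (hA i), mul_comm]
    have := Finset.single_le_sum (f := fun i => A i * x i ^ 2)
      (fun i _ => mul_nonneg (hA i).le (sq_nonneg _)) (Finset.mem_univ i)
    exact (this.trans hx).trans (le_abs_self r)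
  have h2 : ‖x‖ ^ 2 ≤ ∑ i, |r| / A i := by
    rw [EuclideanSpace.norm_sq_eq]
    exact Finset.sum_le_sum fun i _ => by simpa using h1 i
  nlinarith [norm_nonneg x, sq_nonneg (‖x‖ - 1)]

theorem isCompact_quad_le {A : Fin 3 → ℝ} (hA : ∀ i, 0 < A i) (r : ℝ) :
    IsCompact {x : R3 | quad A x ≤ r} := by
  obtain ⟨R, -, hR⟩ := exists_norm_le_of_quad_le hA r
  refine (isCompact_closedBall (0 : R3) R).of_isClosed_subset
    (isClosed_le (continuous_quad A) continuous_const) fun x hx => ?_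
  simpa using hR x hx

theorem isCompact_ellipsoid {A : Fin 3 → ℝ} (hA : ∀ i, 0 < A i) : IsCompact (ellipsoid A) :=
  isCompact_quad_le hA 1

theorem continuous_partialDeriv {f : R3 → ℂ} (hf : ContDiff ℝ 1 f) (i : Fin 3) :
    Continuous (partialDeriv i f) :=
  (hf.continuous_fderiv one_ne_zero).clm_apply continuous_const

theorem continuous_divergence {V : Fin 3 → R3 → ℂ} (hV : ∀ i, ContDiff ℝ 1 (V i)) :
    Continuous (divergence V) :=
  continuous_finsetSum _ fun i _ => continuous_partialDeriv (hV i) i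

/-- A `C¹` function which vanishes on the boundary of the ellipsoid is, just outside of it, bounded
by a multiple of `quad A - 1`, that is, of the distance to the boundary. -/
theorem exists_norm_le_quad_sub_one {A : Fin 3 → ℝ} (hA : ∀ i, 0 < A i) {f : R3 → ℂ}
    (hf : ContDiff ℝ 1 f) (h0 : ∀ x, quad A x = 1 → f x = 0) :
    ∃ C : ℝ, 0 ≤ C ∧ ∀ x, 1 ≤ quad A x → quad A x ≤ 2 → ‖f x‖ ≤ C * (quad A x - 1) := by
  obtain ⟨R, hR0, hR⟩ := exists_norm_le_of_quad_le hA 2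
  obtain ⟨L, hL⟩ := (isCompact_closedBall (0 : R3) R).exists_bound_of_continuousOn
    (hf.continuous_fderiv one_ne_zero).continuousOn
  have hL0 : 0 ≤ L := (norm_nonneg _).trans (hL 0 (by simp [hR0.le]))
  refine ⟨L * R, by positivity, fun x h1 h2 => ?_⟩
  -- compare with the value at the radial projection `y` of `x` on the boundary
  set r := √(quad A x) with hr
  have hr1 : 1 ≤ r := Real.one_le_sqrt.2 h1
  have hr2 : r ^ 2 = quad A x := Real.sq_sqrt (by linarith)
  set y := r⁻¹ • x with hy
  have hqy : quad A y = 1 := by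
    rw [hy, quad_smul, ← hr2, ← mul_pow, inv_mul_cancel₀ (by positivity), one_pow]
  have hx : x ∈ Metric.closedBall (0 : R3) R := by simpa using hR x h2
  have hyR : y ∈ Metric.closedBall (0 : R3) R := by simpa using hR y (by linarith)
  have := (convex_closedBall (0 : R3) R).norm_image_sub_le_of_norm_fderiv_le
    (fun z _ => hf.differentiable one_ne_zero z) hL hyR hx
  rw [h0 y hqy, sub_zero] at this
  refine this.trans ?_
  rw [mul_assoc]
  refine mul_le_mul_of_nonneg_left ?_ hL0
  have hxy : x - y = (r - 1) • y := by
    rw [sub_smul, one_smul, hy, smul_smul, mul_inv_cancel₀ (by positivity), one_smul]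
  rw [hxy, norm_smul, Real.norm_of_nonneg (by linarith), mul_comm]
  have hyR' : ‖y‖ ≤ R := by simpa using hyR
  have : r - 1 ≤ quad A x - 1 := by nlinarith
  exact mul_le_mul hyR' this (by linarith) hR0.le

theorem deriv_smoothTransition_of_one_lt {s : ℝ} (hs : 1 < s) :
    deriv Real.smoothTransition s = 0 := by
  have : Real.smoothTransition =ᶠ[nhds s] fun _ => 1 := by
    filter_upwards [lt_mem_nhds hs] with t ht using Real.smoothTransition.one_of_one_le ht.le
  rw [this.deriv_eq, deriv_const]

theorem deriv_smoothTransition_of_neg {s : ℝ} (hs : s < 0) :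
    deriv Real.smoothTransition s = 0 := by
  have : Real.smoothTransition =ᶠ[nhds s] fun _ => 0 := by
    filter_upwards [gt_mem_nhds hs] with t ht using Real.smoothTransition.zero_of_nonpos ht.le
  rw [this.deriv_eq, deriv_const]

theorem exists_deriv_smoothTransition_le :
    ∃ D : ℝ, ∀ s, |deriv Real.smoothTransition s| ≤ D := by
  have hc : Continuous (deriv Real.smoothTransition) :=
    (Real.smoothTransition.contDiff (n := 1)).continuous_deriv (by simp)
  obtain ⟨D, hD⟩ := (isCompact_Icc (a := (0 : ℝ)) (b := 1)).exists_bound_of_continuousOn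
    hc.continuousOn
  refine ⟨D, fun s => ?_⟩
  have hD0 : 0 ≤ D := (norm_nonneg _).trans (hD 0 (by simp))
  rcases lt_or_ge s 0 with h | h
  · simpa [deriv_smoothTransition_of_neg h] using hD0
  rcases lt_or_ge 1 s with h' | h'
  · simpa [deriv_smoothTransition_of_one_lt h'] using hD0
  · exact hD s ⟨h, h'⟩

/-- A smooth cutoff equal to `1` on the ellipsoid and to `0` for `(n + 1) (quad A x - 1) ≥ 1`. -/
def cutoff (A : Fin 3 → ℝ) (n : ℕ) (x : R3) : ℝ :=
  Real.smoothTransition ((n + 1) * (1 - quad A x) + 1)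

theorem contDiff_cutoff (A : Fin 3 → ℝ) (n : ℕ) : ContDiff ℝ 1 (cutoff A n) :=
  (Real.smoothTransition.contDiff (n := 1)).comp
    ((contDiff_const.mul (contDiff_const.sub (contDiff_quad A))).add contDiff_const)

theorem fderiv_cutoff_single (A : Fin 3 → ℝ) (n : ℕ) (x : R3) (i : Fin 3) :
    fderiv ℝ (cutoff A n) x (EuclideanSpace.single i 1) =
      -(2 * (n + 1) * deriv Real.smoothTransition ((n + 1) * (1 - quad A x) + 1)) *
        (A i * x i) := by
  have h1 : HasDerivAt Real.smoothTransition
      (deriv Real.smoothTransition ((n + 1) * (1 - quad A x) + 1)) ((n + 1) * (1 - quad A x) + 1) :=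
    ((Real.smoothTransition.contDiff (n := 1)).differentiable one_ne_zero _).hasDerivAt
  have hq : HasFDerivAt (quad A) (fderiv ℝ (quad A) x) x :=
    ((contDiff_quad A (n := 1)).differentiable one_ne_zero x).hasFDerivAt
  have h2 := h1.comp_hasFDerivAt x
    (((hq.const_sub 1).const_mul ((n : ℝ) + 1)).add_const 1)
  have h3 : fderiv ℝ (cutoff A n) x = _ := h2.fderiv
  rw [h3]
  simp only [smul_apply, neg_apply, smul_eq_mul,
    fderiv_quad_single]
  ring

theorem cutoff_eq_one {A : Fin 3 → ℝ} (n : ℕ) {x : R3} (hx : quad A x ≤ 1) :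
    cutoff A n x = 1 :=
  Real.smoothTransition.one_of_one_le (by
    have : (0 : ℝ) ≤ (n + 1) * (1 - quad A x) := mul_nonneg (by positivity) (by linarith)
    linarith)

theorem cutoff_eq_zero {A : Fin 3 → ℝ} {n : ℕ} {x : R3} (hx : 1 ≤ (n + 1) * (quad A x - 1)) :
    cutoff A n x = 0 :=
  Real.smoothTransition.zero_of_nonpos (by linarith)

theorem abs_cutoff_le_one (A : Fin 3 → ℝ) (n : ℕ) (x : R3) : |cutoff A n x| ≤ 1 :=
  abs_le.2 ⟨neg_one_lt_zero.le.trans (Real.smoothTransition.nonneg _),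
    Real.smoothTransition.le_one _⟩

theorem cutoff_eq_zero_of_two_le {A : Fin 3 → ℝ} (n : ℕ) {x : R3} (hx : 2 ≤ quad A x) :
    cutoff A n x = 0 :=
  cutoff_eq_zero (by nlinarith [(n.cast_nonneg : (0 : ℝ) ≤ n)])

theorem hasCompactSupport_cutoff {A : Fin 3 → ℝ} (hA : ∀ i, 0 < A i) (n : ℕ) :
    HasCompactSupport (cutoff A n) :=
  HasCompactSupport.intro (isCompact_quad_le hA 2) fun x hx =>
    cutoff_eq_zero_of_two_le n (by simpa using (not_le.1 hx).le)

/-- Integration by parts against the cutoff, in all of space. -/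
theorem integral_cutoff_smul_divergence {A : Fin 3 → ℝ} (hA : ∀ i, 0 < A i)
    {V : Fin 3 → R3 → ℂ} (hV : ∀ i, ContDiff ℝ 1 (V i)) (n : ℕ) :
    ∫ x, cutoff A n x • divergence V x =
      ∫ x, (2 * (n + 1) * deriv Real.smoothTransition ((n + 1) * (1 - quad A x) + 1)) •
        ∑ i, ((A i * x i : ℝ) : ℂ) * V i x := by
  have hc := hasCompactSupport_cutoff hA n
  have hcc := (contDiff_cutoff A n).continuous
  have hi1 : ∀ i, Integrable fun x => cutoff A n x • partialDeriv i (V i) x := fun i =>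
    (hcc.smul (continuous_partialDeriv (hV i) i)).integrable_of_hasCompactSupport hc.smul_right
  have hi2 : ∀ i, Integrable fun x =>
      fderiv ℝ (cutoff A n) x (EuclideanSpace.single i 1) • V i x := fun i =>
    ((((contDiff_cutoff A n).continuous_fderiv one_ne_zero).clm_apply
      continuous_const).smul (hV i).continuous).integrable_of_hasCompactSupport
      ((hc.fderiv_apply (𝕜 := ℝ) _).smul_right)
  have hi3 : ∀ i, Integrable fun x => cutoff A n x • V i x := fun i =>
    (hcc.smul (hV i).continuous).integrable_of_hasCompactSupport hc.smul_right
  simp only [divergence, Finset.smul_sum]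
  rw [integral_finsetSum _ fun i _ => hi1 i]
  have key : ∀ i, ∫ x, cutoff A n x • partialDeriv i (V i) x =
      - ∫ x, fderiv ℝ (cutoff A n) x (EuclideanSpace.single i 1) • V i x := fun i =>
    integral_smul_fderiv_eq_neg_fderiv_smul_of_integrable (hi2 i) (hi1 i) (hi3 i)
      (fun x _ => (contDiff_cutoff A n).differentiable one_ne_zero x)
      (fun x _ => (hV i).differentiable one_ne_zero x)
  simp only [key]
  rw [Finset.sum_neg_distrib, ← integral_finsetSum _ fun i _ => hi2 i, ← integral_neg]
  refine integral_congr_ae (Filter.Eventually.of_forall fun x => ?_)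
  dsimp only
  rw [← Finset.sum_neg_distrib]
  refine Finset.sum_congr rfl fun i _ => ?_
  simp only [fderiv_cutoff_single, Complex.real_smul]
  push_cast
  ring

/-- **Divergence theorem** for fields tangent to the boundary: no boundary term appears. -/
theorem setIntegral_divergence_eq_zero {A : Fin 3 → ℝ} (hA : ∀ i, 0 < A i)
    {V : Fin 3 → R3 → ℂ} (hV : ∀ i, ContDiff ℝ 1 (V i))
    (htan : ∀ x, quad A x = 1 → ∑ i, ((A i * x i : ℝ) : ℂ) * V i x = 0) :
    ∫ x in ellipsoid A, divergence V x = 0 := by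
  set N : R3 → ℂ := fun x => ∑ i, ((A i * x i : ℝ) : ℂ) * V i x with hN
  have hNC : ContDiff ℝ 1 N := ContDiff.sum fun i _ =>
    (Complex.ofRealCLM.contDiff.comp (contDiff_const.mul (contDiff_coord i))).mul (hV i)
  obtain ⟨C, hC0, hC⟩ := exists_norm_le_quad_sub_one hA hNC htan
  obtain ⟨D, hD⟩ := exists_deriv_smoothTransition_le
  have hD0 : 0 ≤ D := (abs_nonneg _).trans (hD 0)
  have hK := isCompact_quad_le hA 2
  have hKm : MeasurableSet {x : R3 | quad A x ≤ 2} := hK.measurableSet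
  have hdst : Continuous (deriv Real.smoothTransition) :=
    (Real.smoothTransition.contDiff (n := 1)).continuous_deriv (by simp)
  -- the left-hand side of the integration by parts tends to the integral over the ellipsoid
  have hleft : Filter.Tendsto (fun n : ℕ => ∫ x, cutoff A n x • divergence V x) Filter.atTop
      (nhds (∫ x in ellipsoid A, divergence V x)) := by
    rw [← integral_indicator (measurableSet_ellipsoid A)]
    refine tendsto_integral_of_dominated_convergence
      ({x : R3 | quad A x ≤ 2}.indicator fun x => ‖divergence V x‖) ?_ ?_ ?_ ?_
    · exact fun n => ((contDiff_cutoff A n).continuous.smul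
        (continuous_divergence hV)).aestronglyMeasurable
    · rw [integrable_indicator_iff hKm]
      exact (continuous_divergence hV).norm.continuousOn.integrableOn_compact hK
    · refine fun n => Filter.Eventually.of_forall fun x => ?_
      by_cases hx : quad A x ≤ 2
      · rw [Set.indicator_of_mem (show x ∈ {x : R3 | quad A x ≤ 2} from hx), norm_smul]
        exact mul_le_of_le_one_left (norm_nonneg _) (abs_cutoff_le_one A n x)
      · rw [cutoff_eq_zero_of_two_le n (not_le.1 hx).le, zero_smul, norm_zero]
        exact Set.indicator_nonneg (fun _ _ => norm_nonneg _) _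
    · refine Filter.Eventually.of_forall fun x => tendsto_const_nhds.congr' ?_
      by_cases hx : quad A x ≤ 1
      · refine Filter.Eventually.of_forall fun n => ?_
        simp only [Set.indicator_of_mem (show x ∈ ellipsoid A from hx), cutoff_eq_one n hx,
          one_smul]
      · obtain ⟨m, hm⟩ := exists_nat_gt (1 / (quad A x - 1))
        filter_upwards [Filter.eventually_ge_atTop m] with n hn
        suffices hn' : 1 ≤ ((n : ℝ) + 1) * (quad A x - 1) by
          simp only [Set.indicator_of_notMem (show x ∉ ellipsoid A from hx),
            cutoff_eq_zero hn', zero_smul]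
        have hpos : 0 < quad A x - 1 := by linarith [not_le.1 hx]
        rw [div_lt_iff₀ hpos] at hm
        have : (m : ℝ) ≤ n := by exact_mod_cast hn
        nlinarith
  -- the right-hand side is an integral over a thin shell of a bounded quantity
  have hright : Filter.Tendsto (fun n : ℕ =>
      ∫ x, (2 * (n + 1) * deriv Real.smoothTransition ((n + 1) * (1 - quad A x) + 1)) • N x)
      Filter.atTop (nhds 0) := by
    rw [← integral_zero R3 ℂ (μ := volume)]
    have hin : ∀ (n : ℕ) (x : R3), quad A x ≤ 1 →
        (2 * (n + 1) * deriv Real.smoothTransition ((n + 1) * (1 - quad A x) + 1)) • N x = 0 := by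
      intro n x hx
      rcases hx.lt_or_eq with h | h
      · rw [deriv_smoothTransition_of_one_lt, mul_zero, zero_smul]
        have : 0 < ((n : ℝ) + 1) * (1 - quad A x) := mul_pos (by positivity) (by linarith)
        linarith
      · rw [hN]
        simp only [htan x h, smul_zero]
    have hout : ∀ (n : ℕ) (x : R3), 1 < ((n : ℝ) + 1) * (quad A x - 1) →
        (2 * (n + 1) * deriv Real.smoothTransition ((n + 1) * (1 - quad A x) + 1)) • N x = 0 := by
      intro n x hx
      rw [deriv_smoothTransition_of_neg (by linarith), mul_zero, zero_smul]
    refine tendsto_integral_of_dominated_convergence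
      ({x : R3 | quad A x ≤ 2}.indicator fun _ => 2 * D * C) ?_ ?_ ?_ ?_
    · intro n
      have : Continuous fun x : R3 =>
          deriv Real.smoothTransition (((n : ℝ) + 1) * (1 - quad A x) + 1) :=
        hdst.comp ((continuous_const.mul (continuous_const.sub (continuous_quad A))).add
          continuous_const)
      exact ((continuous_const.mul this).smul hNC.continuous).aestronglyMeasurable
    · rw [integrable_indicator_iff hKm]
      exact continuous_const.continuousOn.integrableOn_compact hK
    · refine fun n => Filter.Eventually.of_forall fun x => ?_
      have hb : 0 ≤ {x : R3 | quad A x ≤ 2}.indicator (fun _ => 2 * D * C) x :=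
        Set.indicator_nonneg (fun _ _ => by positivity) _
      rcases le_or_gt (quad A x) 1 with h1 | h1
      · rw [hin n x h1, norm_zero]
        exact hb
      rcases lt_or_ge 1 (((n : ℝ) + 1) * (quad A x - 1)) with h2 | h2
      · rw [hout n x h2, norm_zero]
        exact hb
      have hx2 : quad A x ≤ 2 := by nlinarith [(n.cast_nonneg : (0 : ℝ) ≤ n)]
      rw [Set.indicator_of_mem (show x ∈ {x : R3 | quad A x ≤ 2} from hx2), norm_smul,
        Real.norm_eq_abs, abs_mul, abs_of_nonneg (by positivity : (0 : ℝ) ≤ 2 * (n + 1))]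
      have hNx := hC x h1.le hx2
      calc 2 * ((n : ℝ) + 1) * |deriv Real.smoothTransition ((n + 1) * (1 - quad A x) + 1)| * ‖N x‖
          ≤ 2 * ((n : ℝ) + 1) * D * (C * (quad A x - 1)) := by
            gcongr
            exact hD _
        _ = 2 * D * C * (((n : ℝ) + 1) * (quad A x - 1)) := by ring
        _ ≤ 2 * D * C * 1 := by gcongr
        _ = 2 * D * C := mul_one _
    · refine Filter.Eventually.of_forall fun x => tendsto_const_nhds.congr' ?_
      rcases le_or_gt (quad A x) 1 with h1 | h1
      · exact Filter.Eventually.of_forall fun n => (hin n x h1).symm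
      · obtain ⟨m, hm⟩ := exists_nat_gt (1 / (quad A x - 1))
        filter_upwards [Filter.eventually_ge_atTop m] with n hn
        refine (hout n x ?_).symm
        have hpos : 0 < quad A x - 1 := by linarith
        rw [div_lt_iff₀ hpos] at hm
        have : (m : ℝ) ≤ n := by exact_mod_cast hn
        nlinarith
  refine tendsto_nhds_unique hleft (hright.congr fun n => ?_)
  exact (integral_cutoff_smul_divergence hA hV n).symm

/-! ### Positivity of the boundary integral -/

/-- For `0 < s ≤ 1`, the dilated ellipsoid `{quad A ≤ s²}`. -/
theorem smul_ellipsoid (A : Fin 3 → ℝ) {s : ℝ} (hs : 0 < s) :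
    s • ellipsoid A = {x | quad A x ≤ s ^ 2} := by
  ext x
  rw [Set.mem_smul_set_iff_inv_smul_mem₀ hs.ne', mem_ellipsoid, quad_smul, Set.mem_ofPred_eq,
    inv_pow, inv_mul_le_iff₀ (by positivity), mul_one]

/-- The part inside the ellipsoid of the open cone with vertex `0` which spans the ball of
radius `δ` around `x₀` on the boundary. -/
def coneSector (A : Fin 3 → ℝ) (x₀ : R3) (δ : ℝ) : Set R3 :=
  {x | 0 < quad A x ∧ quad A x ≤ 1 ∧ dist ((√(quad A x))⁻¹ • x) x₀ < δ}

theorem measurable_inv_sqrt_quad_smul (A : Fin 3 → ℝ) :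
    Measurable fun x : R3 => (√(quad A x))⁻¹ • x :=
  (continuous_quad A).measurable.sqrt.inv.smul measurable_id

theorem measurableSet_coneSector (A : Fin 3 → ℝ) (x₀ : R3) (δ : ℝ) :
    MeasurableSet (coneSector A x₀ δ) :=
  (measurableSet_lt measurable_const (continuous_quad A).measurable).inter
    ((measurableSet_le (continuous_quad A).measurable measurable_const).inter
      (measurableSet_lt ((measurable_inv_sqrt_quad_smul A).dist measurable_const)
        measurable_const))

theorem coneSector_subset (A : Fin 3 → ℝ) (x₀ : R3) (δ : ℝ) :
    coneSector A x₀ δ ⊆ ellipsoid A := fun _ hx => hx.2.1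

theorem smul_coneSector (A : Fin 3 → ℝ) (x₀ : R3) (δ : ℝ) {s : ℝ} (hs : 0 < s) (hs1 : s ≤ 1) :
    s • coneSector A x₀ δ = coneSector A x₀ δ ∩ s • ellipsoid A := by
  ext x
  rw [smul_ellipsoid A hs, Set.mem_smul_set_iff_inv_smul_mem₀ hs.ne']
  simp only [coneSector, Set.mem_ofPred_eq, Set.mem_inter_iff, quad_smul]
  have hsqrt : √(s⁻¹ ^ 2 * quad A x) = s⁻¹ * √(quad A x) := by
    rw [Real.sqrt_mul (by positivity), Real.sqrt_sq (by positivity)]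
  have hvec : (√(s⁻¹ ^ 2 * quad A x))⁻¹ • s⁻¹ • x = (√(quad A x))⁻¹ • x := by
    rw [hsqrt, smul_smul]
    congr 1
    field_simp
  have h1 : 0 < s⁻¹ ^ 2 * quad A x ↔ 0 < quad A x :=
    mul_pos_iff_of_pos_left (by positivity)
  have h2 : s⁻¹ ^ 2 * quad A x ≤ 1 ↔ quad A x ≤ s ^ 2 := by
    rw [inv_pow, inv_mul_le_iff₀ (by positivity), mul_one]
  rw [hvec, h1, h2]
  have h3 : s ^ 2 ≤ 1 := pow_le_one₀ hs.le hs1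
  constructor
  · rintro ⟨a, b, c⟩
    exact ⟨⟨a, b.trans h3, c⟩, b⟩
  · rintro ⟨⟨a, _, c⟩, d⟩
    exact ⟨a, d, c⟩

theorem volume_coneSector_ne_top {A : Fin 3 → ℝ} (hA : ∀ i, 0 < A i) (x₀ : R3) (δ : ℝ) :
    volume (coneSector A x₀ δ) ≠ ⊤ :=
  ((measure_mono (coneSector_subset A x₀ δ)).trans_lt
    (isCompact_ellipsoid hA).measure_lt_top).ne

theorem measureReal_coneSector_pos {A : Fin 3 → ℝ} (hA : ∀ i, 0 < A i) {x₀ : R3}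
    (hx₀ : quad A x₀ = 1) {δ : ℝ} (hδ : 0 < δ) : 0 < volume.real (coneSector A x₀ δ) := by
  refine ENNReal.toReal_pos ?_ (volume_coneSector_ne_top hA x₀ δ)
  -- the sector is a neighbourhood of `x₀ / 2`
  have hq : quad A ((1 / 2 : ℝ) • x₀) = 1 / 4 := by rw [quad_smul, hx₀]; norm_num
  have hs : √(1 / 4 : ℝ) = 1 / 2 := by
    rw [show (1 / 4 : ℝ) = (1 / 2) ^ 2 by norm_num, Real.sqrt_sq (by norm_num)]
  refine (Measure.measure_pos_of_mem_nhds volume (x := (1 / 2 : ℝ) • x₀) ?_).ne'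
  have hcq : ContinuousAt (quad A) ((1 / 2 : ℝ) • x₀) := (continuous_quad A).continuousAt
  have hc : ContinuousAt (fun x : R3 => (√(quad A x))⁻¹ • x) ((1 / 2 : ℝ) • x₀) :=
    (hcq.sqrt.inv₀ (by rw [hq, hs]; norm_num)).smul continuousAt_id
  have hball := hc.preimage_mem_nhds (Metric.ball_mem_nhds _ hδ)
  have e1 := hcq.eventually
    (lt_mem_nhds (show 0 < quad A ((1 / 2 : ℝ) • x₀) by rw [hq]; norm_num))
  have e2 := hcq.eventually
    (gt_mem_nhds (show quad A ((1 / 2 : ℝ) • x₀) < 1 by rw [hq]; norm_num))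
  filter_upwards [hball, e1, e2] with x hx h1 h2
  refine ⟨h1, h2.le, ?_⟩
  have : (√(quad A ((1 / 2 : ℝ) • x₀)))⁻¹ • (1 / 2 : ℝ) • x₀ = x₀ := by
    rw [hq, hs, smul_smul]
    norm_num
  rw [Set.mem_preimage, this] at hx
  exact hx

/-- The derivative at `s = 1` of the integral of `F` over the dilated ellipsoid `s • E`. -/
theorem hasDerivAt_integral_dilation {A : Fin 3 → ℝ} (hA : ∀ i, 0 < A i) {F : R3 → ℝ}
    (hF : ContDiff ℝ 1 F) :
    HasDerivAt (fun s : ℝ => ∫ x in ellipsoid A, s ^ 3 * F (s • x))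
      (∫ x in ellipsoid A, (3 * F x + fderiv ℝ F x x)) 1 := by
  have hE := isCompact_ellipsoid hA
  have hFd := hF.differentiable one_ne_zero
  have hFc := hF.continuous
  have hDc := hF.continuous_fderiv one_ne_zero
  set G : ℝ → R3 → ℝ := fun s x => 3 * s ^ 2 * F (s • x) + s ^ 3 * fderiv ℝ F (s • x) x with hG
  have hGc : Continuous fun z : ℝ × R3 => G z.1 z.2 := by
    have h1 : Continuous fun z : ℝ × R3 => z.1 • z.2 := continuous_fst.smul continuous_snd
    exact ((continuous_const.mul (continuous_fst.pow 2)).mul (hFc.comp h1)).add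
      ((continuous_fst.pow 3).mul ((hDc.comp h1).clm_apply continuous_snd))
  obtain ⟨M, hM⟩ := ((isCompact_Icc (a := (0 : ℝ)) (b := 2)).prod hE).exists_bound_of_continuousOn
    hGc.continuousOn
  have hGs : ∀ s, Continuous (G s) := fun s =>
    hGc.comp (continuous_const.prodMk continuous_id)
  have hFs : ∀ s : ℝ, Continuous fun x : R3 => s ^ 3 * F (s • x) := fun s =>
    continuous_const.mul (hFc.comp (continuous_const_smul s))
  have key : HasDerivAt (fun s : ℝ => ∫ x in ellipsoid A, s ^ 3 * F (s • x))
      (∫ x in ellipsoid A, G 1 x) 1 := (hasDerivAt_integral_of_dominated_loc_of_deriv_le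
    (𝕜 := ℝ) (E := ℝ) (x₀ := (1 : ℝ))
    (μ := volume.restrict (ellipsoid A)) (F := fun s x => s ^ 3 * F (s • x)) (F' := G)
    (bound := fun _ => M) (s := Set.Icc 0 2) (Icc_mem_nhds (by norm_num) (by norm_num))
    (Filter.Eventually.of_forall fun s => (hFs s).aestronglyMeasurable)
    ((hFs 1).continuousOn.integrableOn_compact hE) (hGs 1).aestronglyMeasurable ?_ ?_ ?_).2
  · convert key using 1
    refine integral_congr_ae (Filter.Eventually.of_forall fun x => ?_)
    simp [hG]
  · filter_upwards [ae_restrict_mem (measurableSet_ellipsoid A)] with x hx s hs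
    exact hM (s, x) ⟨hs, hx⟩
  · exact continuous_const.continuousOn.integrableOn_compact hE
  · refine Filter.Eventually.of_forall fun x s _ => ?_
    have h1 : HasDerivAt (fun s : ℝ => s • x) x s := by
      simpa using (hasDerivAt_id s).smul_const x
    have h2 := (hFd (s • x)).hasFDerivAt.comp_hasDerivAt s h1
    have h3 := (hasDerivAt_pow 3 s).mul h2
    exact h3.congr_deriv (by simp [hG])

/-- `∫ (3 F + x · ∇F)` over the ellipsoid is the integral of `F` over the boundary, for a measure
which charges each open set of it: if `F ≥ 0` and this integral is zero, `F` vanishes on the boundary.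
When `F x₀ > 0`, the integral of `F` over the shell between `s • E` and `E` is at least a multiple
of the volume of the intersection of the shell with a cone around `x₀`, of order `1 - s`. -/
theorem eq_zero_of_boundary_integral_eq_zero {A : Fin 3 → ℝ} (hA : ∀ i, 0 < A i) {F : R3 → ℝ}
    (hF : ContDiff ℝ 1 F) (hF0 : ∀ x, 0 ≤ F x)
    (hint : ∫ x in ellipsoid A, (3 * F x + fderiv ℝ F x x) = 0) {x₀ : R3} (hx₀ : quad A x₀ = 1) :
    F x₀ = 0 := by
  by_contra hne
  have hpos : 0 < F x₀ := lt_of_le_of_ne (hF0 x₀) (Ne.symm hne)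
  set c := F x₀ / 2 with hc
  have hcpos : 0 < c := by positivity
  obtain ⟨δ, hδ, hball⟩ := Metric.mem_nhds_iff.1
    (hF.continuous.continuousAt.eventually (lt_mem_nhds (show c < F x₀ by linarith)))
  set m := volume.real (coneSector A x₀ (δ / 2)) with hm
  have hmpos : 0 < m := measureReal_coneSector_pos hA hx₀ (by positivity)
  obtain ⟨R, hR0, hR⟩ := exists_norm_le_of_quad_le hA 1
  have hE := isCompact_ellipsoid hA
  have hFE : IntegrableOn F (ellipsoid A) := hF.continuous.continuousOn.integrableOn_compact hE
  set J : ℝ → ℝ := fun s => ∫ x in ellipsoid A, s ^ 3 * F (s • x) with hJ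
  have hderiv : HasDerivAt J 0 1 := hint ▸ hasDerivAt_integral_dilation hA hF
  have hJs : ∀ s : ℝ, 0 < s → J s = ∫ x in s • ellipsoid A, F x := by
    intro s hs
    rw [hJ]
    dsimp only
    rw [integral_const_mul, Measure.setIntegral_comp_smul_of_pos _ _ _ hs]
    simp only [finrank_euclideanSpace, Fintype.card_fin, smul_eq_mul]
    rw [← mul_assoc, mul_inv_cancel₀ (by positivity), one_mul]
  -- the lower bound for the integral over the shell
  have hlow : ∀ s : ℝ, 0 < s → s < 1 → R * (1 - s) ≤ δ / 2 → c * m * (1 - s) ≤ J 1 - J s := by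
    intro s hs hs1 hsR
    have hsub : s • ellipsoid A ⊆ ellipsoid A := by
      rw [smul_ellipsoid A hs]
      exact fun x hx => (show quad A x ≤ s ^ 2 from hx).trans (pow_le_one₀ hs.le hs1.le)
    have hmeas : MeasurableSet (s • ellipsoid A) := (measurableSet_ellipsoid A).const_smul₀ s
    have hsec := measurableSet_coneSector A x₀ (δ / 2)
    rw [hJs s hs, hJs 1 one_pos, one_smul, ← setIntegral_sdiff hmeas hFE hsub]
    set S := coneSector A x₀ (δ / 2) \ s • ellipsoid A with hS
    have hSE : S ⊆ ellipsoid A \ s • ellipsoid A :=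
      Set.sdiff_subset_sdiff_left (coneSector_subset _ _ _)
    have hSm : MeasurableSet S := hsec.diff hmeas
    have hvol : volume.real S = m * (1 - s ^ 3) := by
      have h1 : S = coneSector A x₀ (δ / 2) \ s • coneSector A x₀ (δ / 2) := by
        rw [smul_coneSector A x₀ _ hs hs1.le, hS, Set.sdiff_self_inter]
      rw [h1, measureReal_sdiff (by rw [smul_coneSector A x₀ _ hs hs1.le]
                                    exact Set.inter_subset_left)
        (hsec.const_smul₀ s) (volume_coneSector_ne_top hA _ _), Measure.real,
        Measure.real, Measure.addHaar_smul]
      simp only [finrank_euclideanSpace, Fintype.card_fin, ENNReal.toReal_mul]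
      rw [ENNReal.toReal_ofReal (abs_nonneg _), abs_of_pos (by positivity), hm, Measure.real]
      ring
    have hFS : ∀ x ∈ S, c ≤ F x := by
      rintro x ⟨⟨hx0, hx1, hxd⟩, hxs⟩
      rw [smul_ellipsoid A hs, Set.mem_ofPred_eq, not_le] at hxs
      refine (hball ?_ : c < F x).le
      rw [Metric.mem_ball]
      set r := √(quad A x) with hr
      have hr2 : r ^ 2 = quad A x := Real.sq_sqrt hx0.le
      have hrpos : 0 < r := Real.sqrt_pos.2 hx0
      have hr1 : r ≤ 1 := by nlinarith
      have hrs : s < r := lt_of_pow_lt_pow_left₀ 2 hrpos.le (by rw [hr2]; exact hxs)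
      have hy : ‖r⁻¹ • x‖ ≤ R := hR _ (by
        rw [quad_smul, ← hr2, ← mul_pow, inv_mul_cancel₀ hrpos.ne', one_pow])
      have hxy : dist x (r⁻¹ • x) ≤ R * (1 - s) := by
        have : x - r⁻¹ • x = (r - 1) • r⁻¹ • x := by
          rw [smul_smul, sub_mul, mul_inv_cancel₀ hrpos.ne', one_mul, sub_smul, one_smul]
        rw [dist_eq_norm, this, norm_smul, Real.norm_eq_abs, abs_sub_comm,
          abs_of_nonneg (by linarith), mul_comm]
        exact mul_le_mul hy (by linarith) (by linarith) hR0.le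
      calc dist x x₀ ≤ dist x (r⁻¹ • x) + dist (r⁻¹ • x) x₀ := dist_triangle _ _ _
        _ < δ := by linarith
    calc c * m * (1 - s) ≤ c * (m * (1 - s ^ 3)) := by
          rw [mul_assoc]
          have : 1 - s ≤ 1 - s ^ 3 := by nlinarith [mul_pos hs hs, mul_pos (mul_pos hs hs) hs]
          gcongr
      _ = ∫ _ in S, c := by rw [setIntegral_const, hvol, smul_eq_mul, mul_comm]
      _ ≤ ∫ x in S, F x := setIntegral_mono_on
          (integrableOn_const ((measure_mono (hSE.trans Set.sdiff_subset)).trans_lt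
            hE.measure_lt_top).ne) (hFE.mono_set (hSE.trans Set.sdiff_subset)) hSm hFS
      _ ≤ ∫ x in ellipsoid A \ s • ellipsoid A, F x :=
          setIntegral_mono_set (hFE.mono_set Set.sdiff_subset)
            (Filter.Eventually.of_forall hF0) hSE.eventuallyLE
  -- this contradicts `J' 1 = 0`
  have hsmall := (hasDerivAt_iff_isLittleO.1 hderiv).def (show 0 < c * m / 2 by positivity)
  have hleft : ∀ᶠ s : ℝ in nhdsWithin 1 (Set.Iio 1), False := by
    have hlim : Filter.Tendsto (fun s : ℝ => R * (1 - s)) (nhds 1) (nhds (R * (1 - 1))) :=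
      (continuous_const.mul (continuous_const.sub continuous_id)).tendsto 1
    have h3 := hlim.eventually (gt_mem_nhds (show R * (1 - 1) < δ / 2 by simpa using hδ))
    filter_upwards [self_mem_nhdsWithin, nhdsWithin_le_nhds hsmall, nhdsWithin_le_nhds h3,
      nhdsWithin_le_nhds (lt_mem_nhds (zero_lt_one' ℝ))] with s hs1 hs2 hs3 hs0
    have hs1' : s < 1 := hs1
    have h := hlow s hs0 hs1' hs3.le
    simp only [smul_zero, sub_zero, Real.norm_eq_abs] at hs2
    rw [abs_sub_comm s 1, abs_of_pos (by linarith : 0 < 1 - s), abs_sub_comm] at hs2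
    have := (le_abs_self _).trans hs2
    nlinarith [mul_pos (mul_pos hcpos hmpos) (by linarith : 0 < 1 - s)]
  exact (Filter.eventually_const.1 hleft)

/-! ### Continuous fields as elements of `L²` -/

/-- The vector field with coefficients `V 0, V 1, V 2`. -/
def vecField (V : Fin 3 → R3 → ℂ) (x : R3) : C3 := WithLp.toLp 2 fun i => V i x

theorem gradField_eq_vecField (φ : R3 → ℂ) :
    gradField φ = vecField fun i => partialDeriv i φ := rfl

theorem continuous_vecField {V : Fin 3 → R3 → ℂ} (hV : ∀ i, Continuous (V i)) :
    Continuous (vecField V) :=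
  (PiLp.continuous_toLp 2 _).comp (continuous_pi hV)

theorem norm_le_sum_norm (v : C3) : ‖v‖ ≤ ∑ i, ‖v i‖ := by
  rw [EuclideanSpace.norm_eq, Real.sqrt_le_left (Finset.sum_nonneg fun i _ => norm_nonneg _)]
  exact Finset.sum_sq_le_sq_sum_of_nonneg fun i _ => norm_nonneg _

theorem isFiniteMeasure_ellipsoidMeasure {A : Fin 3 → ℝ} (hA : ∀ i, 0 < A i) :
    IsFiniteMeasure (ellipsoidMeasure A) :=
  isFiniteMeasure_restrict.2 (isCompact_ellipsoid hA).measure_lt_top.ne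

theorem memLp_of_continuous {A : Fin 3 → ℝ} (hA : ∀ i, 0 < A i) {g : R3 → C3}
    (hg : Continuous g) : MemLp g 2 (ellipsoidMeasure A) := by
  have := isFiniteMeasure_ellipsoidMeasure hA
  obtain ⟨C, hC⟩ := (isCompact_ellipsoid hA).exists_bound_of_continuousOn hg.continuousOn
  exact MemLp.of_bound hg.aestronglyMeasurable C
    (ae_restrict_of_forall_mem (measurableSet_ellipsoid A) hC)

/-- The element of `L²` defined by a field with continuous coefficients. -/
def fieldL2 {A : Fin 3 → ℝ} (hA : ∀ i, 0 < A i) (V : Fin 3 → R3 → ℂ)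
    (hV : ∀ i, Continuous (V i)) : L2Fields A :=
  (memLp_of_continuous hA (continuous_vecField hV)).toLp (vecField V)

section fieldL2

variable {A : Fin 3 → ℝ} (hA : ∀ i, 0 < A i)

theorem coeFn_fieldL2 {V : Fin 3 → R3 → ℂ} (hV : ∀ i, Continuous (V i)) :
    ⇑(fieldL2 hA V hV) =ᵐ[ellipsoidMeasure A] vecField V :=
  MemLp.coeFn_toLp _

theorem eq_fieldL2 {V : Fin 3 → R3 → ℂ} (hV : ∀ i, Continuous (V i)) {u : L2Fields A}
    (hu : ⇑u =ᵐ[ellipsoidMeasure A] vecField V) : u = fieldL2 hA V hV :=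
  Lp.ext (hu.trans (coeFn_fieldL2 hA hV).symm)

theorem inner_fieldL2 {V W : Fin 3 → R3 → ℂ} (hV : ∀ i, Continuous (V i))
    (hW : ∀ i, Continuous (W i)) :
    ⟪fieldL2 hA V hV, fieldL2 hA W hW⟫_ℂ = ∫ x in ellipsoid A, ∑ i, conj (V i x) * W i x := by
  rw [L2.inner_def]
  refine integral_congr_ae ?_
  filter_upwards [coeFn_fieldL2 hA hV, coeFn_fieldL2 hA hW] with x h1 h2
  rw [h1, h2, PiLp.inner_apply]
  refine Finset.sum_congr rfl fun i _ => ?_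
  simp only [RCLike.inner_apply, vecField]
  ring

theorem norm_fieldL2_le {V : Fin 3 → R3 → ℂ} (hV : ∀ i, Continuous (V i)) {C : ℝ} (hC0 : 0 ≤ C)
    (hC : ∀ x ∈ ellipsoid A, ‖vecField V x‖ ≤ C) :
    ‖fieldL2 hA V hV‖ ≤ (ellipsoidMeasure A).real Set.univ ^ (1 / 2 : ℝ) * C := by
  have := isFiniteMeasure_ellipsoidMeasure hA
  have h : ∀ᵐ x ∂ellipsoidMeasure A, ‖fieldL2 hA V hV x‖ ≤ C := by
    filter_upwards [coeFn_fieldL2 hA hV, ae_restrict_mem (measurableSet_ellipsoid A)] with x h1 h2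
    rw [h1]
    exact hC x h2
  have := Lp.norm_le_of_ae_bound (p := 2) hC0 h
  simpa [measureUnivNNReal, Measure.real, ENNReal.coe_toNNReal_eq_toReal] using this

theorem mem_solenoidal_iff_inner (u : L2Fields A) :
    u ∈ solenoidal A ↔ ∀ g ∈ smoothGradients A, ⟪g, u⟫_ℂ = 0 := by
  rw [solenoidal, Submodule.mem_orthogonal]
  refine ⟨fun h g hg => h g (Submodule.subset_span hg), fun h g hg => ?_⟩
  induction hg using Submodule.span_induction with
  | mem g hg => exact h g hg
  | zero => exact inner_zero_left _
  | add g k _ _ hg hk => rw [inner_add_left, hg, hk, add_zero]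
  | smul c g _ hg => rw [inner_smul_left, hg, mul_zero]

theorem continuous_partialDeriv_of_smooth {φ : R3 → ℂ} (hφ : ContDiff ℝ ∞ φ) (i : Fin 3) :
    Continuous (partialDeriv i φ) :=
  continuous_partialDeriv (hφ.of_le (by exact_mod_cast le_top)) i

theorem fieldL2_grad_mem {φ : R3 → ℂ} (hφ : ContDiff ℝ ∞ φ) :
    fieldL2 hA (fun i => partialDeriv i φ) (continuous_partialDeriv_of_smooth hφ) ∈
      smoothGradients A :=
  ⟨φ, hφ, coeFn_fieldL2 hA _⟩

theorem fieldL2_mem_solenoidal_iff {V : Fin 3 → R3 → ℂ} (hV : ∀ i, Continuous (V i)) :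
    fieldL2 hA V hV ∈ solenoidal A ↔ ∀ φ : R3 → ℂ, ContDiff ℝ ∞ φ →
      ∫ x in ellipsoid A, ∑ i, conj (partialDeriv i φ x) * V i x = 0 := by
  rw [mem_solenoidal_iff_inner]
  constructor
  · intro h φ hφ
    rw [← inner_fieldL2 hA (continuous_partialDeriv_of_smooth hφ) hV]
    exact h _ (fieldL2_grad_mem hA hφ)
  · rintro h g ⟨φ, hφ, hg⟩
    rw [eq_fieldL2 hA (continuous_partialDeriv_of_smooth hφ) hg, inner_fieldL2]
    exact h φ hφ

end fieldL2

/-! ### Rules of calculus for partial derivatives -/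

theorem partialDeriv_mul {f g : R3 → ℂ} {x : R3} (hf : DifferentiableAt ℝ f x)
    (hg : DifferentiableAt ℝ g x) (i : Fin 3) :
    partialDeriv i (fun x => f x * g x) x =
      f x * partialDeriv i g x + partialDeriv i f x * g x := by
  simp only [partialDeriv]
  rw [fderiv_fun_mul hf hg]
  simp only [add_apply, smul_apply, smul_eq_mul]
  ring

theorem partialDeriv_sub {f g : R3 → ℂ} {x : R3} (hf : DifferentiableAt ℝ f x)
    (hg : DifferentiableAt ℝ g x) (i : Fin 3) :
    partialDeriv i (fun x => f x - g x) x = partialDeriv i f x - partialDeriv i g x := by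
  simp only [partialDeriv]
  rw [fderiv_fun_sub hf hg]
  rfl

theorem partialDeriv_conj {f : R3 → ℂ} {x : R3} (hf : DifferentiableAt ℝ f x) (i : Fin 3) :
    partialDeriv i (fun x => conj (f x)) x = conj (partialDeriv i f x) := by
  have h : HasFDerivAt (fun x => conj (f x))
      ((Complex.conjCLE : ℂ →L[ℝ] ℂ).comp (fderiv ℝ f x)) x :=
    (Complex.conjCLE : ℂ →L[ℝ] ℂ).hasFDerivAt.comp x hf.hasFDerivAt
  simp only [partialDeriv]
  rw [h.fderiv]
  rfl

theorem partialDeriv_ofReal {f : R3 → ℝ} {x : R3} (hf : DifferentiableAt ℝ f x) (i : Fin 3) :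
    partialDeriv i (fun x => (f x : ℂ)) x = (fderiv ℝ f x (EuclideanSpace.single i 1) : ℝ) := by
  have h : HasFDerivAt (fun x => (f x : ℂ)) (Complex.ofRealCLM.comp (fderiv ℝ f x)) x :=
    Complex.ofRealCLM.hasFDerivAt.comp x hf.hasFDerivAt
  simp only [partialDeriv]
  rw [h.fderiv]
  rfl

theorem partialDeriv_coord (i j : Fin 3) (x : R3) :
    partialDeriv i (fun x => ((x j : ℝ) : ℂ)) x = if i = j then 1 else 0 := by
  rw [partialDeriv_ofReal (hasFDerivAt_coord j x).differentiableAt, (hasFDerivAt_coord j x).fderiv]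
  by_cases h : i = j <;> simp [h, eq_comm]

theorem contDiff_conj {n : WithTop ℕ∞} {f : R3 → ℂ} (hf : ContDiff ℝ n f) :
    ContDiff ℝ n fun x => conj (f x) :=
  (Complex.conjCLE : ℂ →L[ℝ] ℂ).contDiff.comp hf

theorem contDiff_ofReal {n : WithTop ℕ∞} {f : R3 → ℝ} (hf : ContDiff ℝ n f) :
    ContDiff ℝ n fun x => (f x : ℂ) :=
  Complex.ofRealCLM.contDiff.comp hf

/-- Green's formula `∫ conj ∇φ · V = - ∫ conj φ div V`, when `conj φ V` is tangent to the
boundary. -/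
theorem setIntegral_conj_grad_mul_add {A : Fin 3 → ℝ} (hA : ∀ i, 0 < A i) {φ : R3 → ℂ}
    (hφ : ContDiff ℝ 1 φ) {V : Fin 3 → R3 → ℂ} (hV : ∀ i, ContDiff ℝ 1 (V i))
    (htan : ∀ x, quad A x = 1 → conj (φ x) * ∑ i, ((A i * x i : ℝ) : ℂ) * V i x = 0) :
    ∫ x in ellipsoid A, (∑ i, conj (partialDeriv i φ x) * V i x +
      conj (φ x) * divergence V x) = 0 := by
  rw [← setIntegral_divergence_eq_zero hA (V := fun i x => conj (φ x) * V i x)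
    (fun i => (contDiff_conj hφ).mul (hV i)) ?_]
  · refine integral_congr_ae (Filter.Eventually.of_forall fun x => ?_)
    simp only [divergence, Finset.mul_sum]
    rw [← Finset.sum_add_distrib]
    refine Finset.sum_congr rfl fun i _ => ?_
    rw [partialDeriv_mul ((contDiff_conj hφ).differentiable one_ne_zero x)
      ((hV i).differentiable one_ne_zero x),
      partialDeriv_conj (hφ.differentiable one_ne_zero x)]
    ring
  · intro x hx
    rw [← htan x hx, Finset.mul_sum]
    exact Finset.sum_congr rfl fun i _ => by ring

theorem fieldL2_mem_solenoidal {A : Fin 3 → ℝ} (hA : ∀ i, 0 < A i) {V : Fin 3 → R3 → ℂ}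
    (hV : ∀ i, ContDiff ℝ 1 (V i)) (hdiv : ∀ x, divergence V x = 0)
    (htan : ∀ x, quad A x = 1 → ∑ i, ((A i * x i : ℝ) : ℂ) * V i x = 0) :
    fieldL2 hA V (fun i => (hV i).continuous) ∈ solenoidal A := by
  rw [fieldL2_mem_solenoidal_iff]
  intro φ hφ
  have := setIntegral_conj_grad_mul_add hA (φ := φ) (hφ.of_le (by exact_mod_cast le_top)) hV
    (fun x hx => by rw [htan x hx, mul_zero])
  simpa only [hdiv, mul_zero, add_zero] using this

/-! ### Polynomial fields -/

/-- The function on `ℝ³` defined by a polynomial with complex coefficients. -/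
def evalReal (p : MvPolynomial (Fin 3) ℂ) (x : R3) : ℂ :=
  MvPolynomial.eval (fun j => (x j : ℂ)) p

theorem polyField_eq_vecField (p : Fin 3 → MvPolynomial (Fin 3) ℂ) :
    polyField p = vecField fun i => evalReal (p i) := rfl

theorem evalReal_C (a : ℂ) : evalReal (MvPolynomial.C a) = fun _ => a :=
  funext fun _ => MvPolynomial.eval_C a

theorem evalReal_add (p q : MvPolynomial (Fin 3) ℂ) :
    evalReal (p + q) = fun x => evalReal p x + evalReal q x :=
  funext fun _ => map_add _ p q

theorem evalReal_mul_X (p : MvPolynomial (Fin 3) ℂ) (j : Fin 3) :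
    evalReal (p * MvPolynomial.X j) = fun x => evalReal p x * ((x j : ℝ) : ℂ) := by
  funext x
  simp [evalReal]

theorem contDiff_evalReal {n : WithTop ℕ∞} (p : MvPolynomial (Fin 3) ℂ) :
    ContDiff ℝ n (evalReal p) := by
  induction p using MvPolynomial.induction_on with
  | C a =>
    rw [evalReal_C]
    exact contDiff_const
  | add p q hp hq =>
    rw [evalReal_add]
    exact hp.add hq
  | mul_X p j hp =>
    rw [evalReal_mul_X]
    exact hp.mul (contDiff_ofReal (contDiff_coord j))

theorem continuous_evalReal (p : MvPolynomial (Fin 3) ℂ) : Continuous (evalReal p) :=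
  (contDiff_evalReal (n := 1) p).continuous

theorem differentiable_evalReal (p : MvPolynomial (Fin 3) ℂ) : Differentiable ℝ (evalReal p) :=
  (contDiff_evalReal (n := 1) p).differentiable one_ne_zero

theorem partialDeriv_evalReal (i : Fin 3) (p : MvPolynomial (Fin 3) ℂ) :
    partialDeriv i (evalReal p) = evalReal (MvPolynomial.pderiv i p) := by
  funext x
  induction p using MvPolynomial.induction_on with
  | C a =>
    simp [partialDeriv, evalReal_C, evalReal]
  | add p q hp hq =>
    rw [map_add, evalReal_add, evalReal_add]
    dsimp only
    rw [← hp, ← hq]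
    simp only [partialDeriv]
    rw [fderiv_fun_add (differentiable_evalReal p x) (differentiable_evalReal q x)]
    rfl
  | mul_X p j hp =>
    rw [evalReal_mul_X, partialDeriv_mul (differentiable_evalReal p x)
      ((contDiff_ofReal (contDiff_coord j)).differentiable one_ne_zero x), partialDeriv_coord, hp]
    by_cases hij : i = j <;>
      simp [evalReal, hij, MvPolynomial.pderiv_X, eq_comm] <;> ring

theorem divergence_evalReal (p : Fin 3 → MvPolynomial (Fin 3) ℂ) (x : R3) :
    divergence (fun i => evalReal (p i)) x = evalReal (∑ i, MvPolynomial.pderiv i (p i)) x := by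
  simp only [divergence, partialDeriv_evalReal]
  simp [evalReal, map_sum]

theorem totalDegree_pderiv_le (i : Fin 3) (p : MvPolynomial (Fin 3) ℂ) :
    (MvPolynomial.pderiv i p).totalDegree ≤ p.totalDegree - 1 := by
  conv_lhs => rw [p.as_sum, map_sum]
  refine MvPolynomial.totalDegree_finsetSum_le fun s hs => ?_
  rw [MvPolynomial.pderiv_monomial]
  by_cases h0 : s i = 0
  · simp [h0]
  have hs' := MvPolynomial.le_totalDegree hs
  refine (MvPolynomial.totalDegree_monomial_le _ _).trans ?_
  have hle : Finsupp.single i 1 ≤ s := by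
    rw [Finsupp.single_le_iff]
    omega
  have hsum : (s - Finsupp.single i 1).degree + 1 = s.degree := by
    conv_rhs => rw [← tsub_add_cancel_of_le hle]
    rw [map_add, Finsupp.degree_single]
  change (s - Finsupp.single i 1).degree ≤ _
  change s.degree ≤ _ at hs'
  omega

/-- A polynomial which vanishes inside the ellipsoid is zero. -/
theorem eq_zero_of_evalReal_eq_zero (A : Fin 3 → ℝ) {p : MvPolynomial (Fin 3) ℂ}
    (hp : ∀ x, quad A x < 1 → evalReal p x = 0) : p = 0 := by
  have hc : Continuous fun x : Fin 3 → ℝ => quad A (WithLp.toLp 2 x) :=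
    (continuous_quad A).comp (PiLp.continuous_toLp 2 _)
  have h0 : quad A (WithLp.toLp 2 (0 : Fin 3 → ℝ)) < 1 := by simp [quad]
  obtain ⟨ε, hε, hball⟩ := Metric.mem_nhds_iff.1 (hc.continuousAt.eventually (gt_mem_nhds h0))
  refine MvPolynomial.funext_set (fun _ => Complex.ofReal '' Set.Ioo (-ε) ε)
    (fun _ => (Set.Ioo_infinite (by linarith)).image Complex.ofReal_injective.injOn) ?_
  intro z hz
  choose y hy hyz using fun i => hz i (Set.mem_univ i)
  have hyball : y ∈ Metric.ball (0 : Fin 3 → ℝ) ε := by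
    rw [Metric.mem_ball, dist_pi_lt_iff hε]
    intro i
    rw [Pi.zero_apply, Real.dist_eq, sub_zero]
    exact abs_lt.2 (hy i)
  have := hp (WithLp.toLp 2 y) (hball hyball)
  rw [evalReal] at this
  rw [map_zero, ← this]
  congr 2
  funext i
  exact (hyz i).symm

/-- A continuous function `≥ 0` with integral zero over the ellipsoid vanishes inside of it. -/
theorem eq_zero_of_setIntegral_eq_zero {A : Fin 3 → ℝ} (hA : ∀ i, 0 < A i) {F : R3 → ℝ}
    (hF : Continuous F) (hF0 : ∀ x ∈ ellipsoid A, 0 ≤ F x) (hint : ∫ x in ellipsoid A, F x = 0)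
    {x : R3} (hx : quad A x < 1) : F x = 0 := by
  have h1 := (setIntegral_eq_zero_iff_of_nonneg_ae
    (ae_restrict_of_forall_mem (measurableSet_ellipsoid A) hF0)
    (hF.continuousOn.integrableOn_compact (isCompact_ellipsoid hA))).1 hint
  have hU : IsOpen {x : R3 | quad A x < 1} := isOpen_lt (continuous_quad A) continuous_const
  have hsub : {x : R3 | quad A x < 1} ⊆ ellipsoid A := fun x hx =>
    (show quad A x < 1 from hx).le
  exact Measure.eqOn_open_of_ae_eq (μ := volume) (ae_restrict_of_ae_restrict_of_subset hsub h1) hU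
    hF.continuousOn continuousOn_const hx

/-- The polynomial `A₁ X₁² + A₂ X₂² + A₃ X₃²`. -/
def quadPoly (A : Fin 3 → ℝ) : MvPolynomial (Fin 3) ℂ :=
  ∑ i, MvPolynomial.C (A i : ℂ) * MvPolynomial.X i ^ 2

theorem evalReal_quadPoly (A : Fin 3 → ℝ) (x : R3) : evalReal (quadPoly A) x = quad A x := by
  simp [evalReal, quadPoly, quad]

theorem totalDegree_quadPoly_le (A : Fin 3 → ℝ) : (quadPoly A).totalDegree ≤ 2 := by
  refine MvPolynomial.totalDegree_finsetSum_le fun i _ => ?_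
  refine (MvPolynomial.totalDegree_mul _ _).trans ?_
  simp

/-- The polynomial field `p` is orthogonal to the gradients of the polynomials of degree at most
`n + 1`. -/
def OrthogonalToPolyGrads (A : Fin 3 → ℝ) (n : ℕ) (p : Fin 3 → MvPolynomial (Fin 3) ℂ) : Prop :=
  ∀ φ : MvPolynomial (Fin 3) ℂ, φ.totalDegree ≤ n + 1 →
    ∫ x in ellipsoid A, ∑ i, conj (evalReal (MvPolynomial.pderiv i φ) x) * evalReal (p i) x = 0

section

variable {A : Fin 3 → ℝ} (hA : ∀ i, 0 < A i) {n : ℕ} {p : Fin 3 → MvPolynomial (Fin 3) ℂ}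

include hA

/-- The test function is `(1 - quad A) div p`, of degree `n + 1`, which vanishes on the boundary. -/
theorem OrthogonalToPolyGrads.divFree (hp : ∀ i, (p i).totalDegree ≤ n)
    (h : OrthogonalToPolyGrads A n p) : DivFree p := by
  set d := ∑ i, MvPolynomial.pderiv i (p i) with hd
  change d = 0
  have hdeg : d.totalDegree ≤ n - 1 :=
    MvPolynomial.totalDegree_finsetSum_le fun i _ =>
      (totalDegree_pderiv_le i (p i)).trans (Nat.sub_le_sub_right (hp i) 1)
  rcases Nat.eq_zero_or_pos n with rfl | hn
  · refine Finset.sum_eq_zero fun i _ => ?_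
    have h0 : (p i).totalDegree = 0 := Nat.le_zero.1 (hp i)
    rw [MvPolynomial.totalDegree_eq_zero_iff_eq_C.1 h0, MvPolynomial.pderiv_C]
  set φ := (1 - quadPoly A) * d with hφ
  have hφdeg : φ.totalDegree ≤ n + 1 := by
    refine (MvPolynomial.totalDegree_mul _ _).trans ?_
    have h1 : (1 - quadPoly A).totalDegree ≤ 2 :=
      (MvPolynomial.totalDegree_sub _ _).trans (max_le (by simp) (totalDegree_quadPoly_le A))
    omega
  have hφe : ∀ x, evalReal φ x = (1 - quad A x : ℝ) * evalReal d x := by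
    intro x
    have : evalReal φ x = (1 - evalReal (quadPoly A) x) * evalReal d x := by
      simp [hφ, evalReal]
    rw [this, evalReal_quadPoly]
    push_cast
    rfl
  have hgreen := setIntegral_conj_grad_mul_add hA (contDiff_evalReal φ)
    (V := fun i => evalReal (p i)) (fun i => contDiff_evalReal (p i)) (by
      intro x hx
      rw [hφe, hx]
      simp)
  have hE := isCompact_ellipsoid hA
  rw [integral_add] at hgreen
  rotate_left
  · exact (continuous_finsetSum _ fun i _ => (Complex.continuous_conj.comp
      (continuous_partialDeriv (contDiff_evalReal φ) i)).mul
      (continuous_evalReal (p i))).continuousOn.integrableOn_compact hE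
  · exact ((Complex.continuous_conj.comp (continuous_evalReal φ)).mul (continuous_divergence
      fun i => contDiff_evalReal (p i))).continuousOn.integrableOn_compact hE
  simp only [partialDeriv_evalReal, h φ hφdeg, zero_add] at hgreen
  have hzero : ∫ x in ellipsoid A, (1 - quad A x) * Complex.normSq (evalReal d x) = 0 := by
    have h2 : ∫ x in ellipsoid A,
        (((1 - quad A x) * Complex.normSq (evalReal d x) : ℝ) : ℂ) = 0 := by
      rw [← hgreen]
      refine integral_congr_ae (Filter.Eventually.of_forall fun x => ?_)
      dsimp only
      rw [divergence_evalReal, hφe, map_mul, Complex.conj_ofReal, Complex.ofReal_mul,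
        Complex.normSq_eq_conj_mul_self, mul_assoc]
    rw [integral_complex_ofReal] at h2
    exact_mod_cast h2
  refine eq_zero_of_evalReal_eq_zero A fun x hx => ?_
  have := eq_zero_of_setIntegral_eq_zero hA (F := fun x =>
    (1 - quad A x) * Complex.normSq (evalReal d x))
    ((continuous_const.sub (continuous_quad A)).mul
      (Complex.continuous_normSq.comp (continuous_evalReal d)))
    (fun x hx => mul_nonneg (sub_nonneg.2 hx) (Complex.normSq_nonneg _)) hzero hx
  rcases mul_eq_zero.1 this with h3 | h3
  · linarith
  · exact Complex.normSq_eq_zero.1 h3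

/-- The test function is the normal component `f = ∑ Aᵢ xᵢ pᵢ` itself, of degree `n + 1`. The
field `conj f • p - |f|² x` is tangent to the boundary, so that the boundary integral of `|f|²` is
zero. -/
theorem OrthogonalToPolyGrads.tangentToBoundary (hp : ∀ i, (p i).totalDegree ≤ n)
    (h : OrthogonalToPolyGrads A n p) : TangentToBoundary A p := by
  have hdiv := h.divFree hA hp
  set f : MvPolynomial (Fin 3) ℂ := ∑ i, MvPolynomial.C (A i : ℂ) * MvPolynomial.X i * p i with hf
  have hfdeg : f.totalDegree ≤ n + 1 := by
    refine MvPolynomial.totalDegree_finsetSum_le fun i _ => ?_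
    refine (MvPolynomial.totalDegree_mul _ _).trans ?_
    have h1 : (MvPolynomial.C (A i : ℂ) * MvPolynomial.X i : MvPolynomial (Fin 3) ℂ).totalDegree
        ≤ 1 := (MvPolynomial.totalDegree_mul _ _).trans (by simp)
    have := hp i
    omega
  have hfe : ∀ x, evalReal f x = ∑ i, ((A i * x i : ℝ) : ℂ) * evalReal (p i) x := by
    intro x
    simp [hf, evalReal]
  set F : R3 → ℝ := fun x => Complex.normSq (evalReal f x) with hF
  have hFC : ContDiff ℝ 1 F := by
    have hre : ContDiff ℝ 1 fun x => (evalReal f x).re :=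
      Complex.reCLM.contDiff.comp (contDiff_evalReal f)
    have him : ContDiff ℝ 1 fun x => (evalReal f x).im :=
      Complex.imCLM.contDiff.comp (contDiff_evalReal f)
    exact (hre.mul hre).add (him.mul him)
  have hFd := hFC.differentiable one_ne_zero
  have hFconj : ∀ x, (F x : ℂ) = conj (evalReal f x) * evalReal f x := fun x =>
    Complex.normSq_eq_conj_mul_self
  have hE := isCompact_ellipsoid hA
  set V : Fin 3 → R3 → ℂ := fun i x =>
    conj (evalReal f x) * evalReal (p i) x - ((x i : ℝ) : ℂ) * (F x : ℂ) with hV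
  have hVC : ∀ i, ContDiff ℝ 1 (V i) := fun i =>
    ((contDiff_conj (contDiff_evalReal f)).mul (contDiff_evalReal (p i))).sub
      ((contDiff_ofReal (contDiff_coord i)).mul (contDiff_ofReal hFC))
  have htan : ∀ x, quad A x = 1 → ∑ i, ((A i * x i : ℝ) : ℂ) * V i x = 0 := by
    intro x hx
    have h1 : ∑ i, ((A i * x i : ℝ) : ℂ) * V i x =
        conj (evalReal f x) * (∑ i, ((A i * x i : ℝ) : ℂ) * evalReal (p i) x) -
          (quad A x : ℂ) * F x := by
      simp only [hV, quad, mul_sub, Finset.sum_sub_distrib, Finset.mul_sum, Complex.ofReal_sum,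
        Finset.sum_mul]
      congr 1
      · exact Finset.sum_congr rfl fun i _ => by ring
      · refine Finset.sum_congr rfl fun i _ => ?_
        push_cast
        ring
    rw [h1, ← hfe, ← hFconj, hx]
    simp
  have hdivV : ∀ x, divergence V x =
      ∑ i, conj (evalReal (MvPolynomial.pderiv i f) x) * evalReal (p i) x -
        ((3 * F x + fderiv ℝ F x x : ℝ) : ℂ) := by
    intro x
    have h1 : ∀ i, partialDeriv i (V i) x =
        conj (evalReal (MvPolynomial.pderiv i f) x) * evalReal (p i) x +
        conj (evalReal f x) * evalReal (MvPolynomial.pderiv i (p i)) x -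
        (F x + ((x i * fderiv ℝ F x (EuclideanSpace.single i 1) : ℝ) : ℂ)) := by
      intro i
      have hcf := (contDiff_conj (contDiff_evalReal (n := 1) f)).differentiable one_ne_zero x
      have hpi := differentiable_evalReal (p i) x
      have hxi := (contDiff_ofReal (contDiff_coord (n := 1) i)).differentiable one_ne_zero x
      have hFx := (contDiff_ofReal hFC).differentiable one_ne_zero x
      rw [hV]
      dsimp only
      rw [partialDeriv_sub (hcf.fun_mul hpi) (hxi.fun_mul hFx), partialDeriv_mul hcf hpi,
        partialDeriv_mul hxi hFx, partialDeriv_conj (differentiable_evalReal f x),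
        partialDeriv_coord, partialDeriv_ofReal (hFd x), partialDeriv_evalReal,
        partialDeriv_evalReal, if_pos rfl]
      push_cast
      ring
    have h2 : ∑ i, x i * fderiv ℝ F x (EuclideanSpace.single i 1) = fderiv ℝ F x x := by
      have hx := (EuclideanSpace.basisFun (Fin 3) ℝ).sum_repr x
      calc ∑ i, x i * fderiv ℝ F x (EuclideanSpace.single i 1)
          = fderiv ℝ F x (∑ i, (EuclideanSpace.basisFun (Fin 3) ℝ).repr x i •
            EuclideanSpace.basisFun (Fin 3) ℝ i) := by simp [map_sum]
        _ = fderiv ℝ F x x := by rw [hx]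
    have h3 : ∑ i, evalReal (MvPolynomial.pderiv i (p i)) x = 0 := by
      rw [show ∑ i, evalReal (MvPolynomial.pderiv i (p i)) x =
          evalReal (∑ i, MvPolynomial.pderiv i (p i)) x by simp [evalReal], hdiv]
      simp [evalReal]
    simp only [divergence, h1, Finset.sum_sub_distrib, Finset.sum_add_distrib, ← Finset.mul_sum, h3]
    rw [← Complex.ofReal_sum, ← Complex.ofReal_sum, h2]
    simp
  have hint : ∫ x in ellipsoid A, (3 * F x + fderiv ℝ F x x) = 0 := by
    have h1 := setIntegral_divergence_eq_zero hA hVC htan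
    simp only [hdivV] at h1
    rw [integral_sub, h f hfdeg, zero_sub, neg_eq_zero, integral_complex_ofReal] at h1
    · exact_mod_cast h1
    · exact (continuous_finsetSum _ fun i _ => (Complex.continuous_conj.comp
        (continuous_evalReal _)).mul
        (continuous_evalReal (p i))).continuousOn.integrableOn_compact hE
    · exact (Complex.continuous_ofReal.comp ((continuous_const.mul hFC.continuous).add
        ((hFC.continuous_fderiv one_ne_zero).clm_apply
          continuous_id))).continuousOn.integrableOn_compact hE
  intro x hx
  have := eq_zero_of_boundary_integral_eq_zero hA hFC (fun x => Complex.normSq_nonneg _) hint hx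
  have h0 := Complex.normSq_eq_zero.1 this
  rw [hfe] at h0
  exact h0

end

section

variable {A : Fin 3 → ℝ} (hA : ∀ i, 0 < A i)

/-- The linear map sending a triple of polynomials to the corresponding element of `L²`. -/
def polyL2 : (Fin 3 → MvPolynomial (Fin 3) ℂ) →ₗ[ℂ] L2Fields A where
  toFun p := fieldL2 hA (fun i => evalReal (p i)) fun i => continuous_evalReal (p i)
  map_add' p q := by
    symm
    refine eq_fieldL2 hA _ ?_
    filter_upwards [Lp.coeFn_add (fieldL2 hA (fun i => evalReal (p i)) fun i =>
      continuous_evalReal (p i)) (fieldL2 hA (fun i => evalReal (q i)) fun i =>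
      continuous_evalReal (q i)), coeFn_fieldL2 hA fun i => continuous_evalReal (p i),
      coeFn_fieldL2 hA fun i => continuous_evalReal (q i)] with x hx hp hq
    rw [hx, Pi.add_apply, hp, hq]
    ext i
    simp [vecField, evalReal_add]
  map_smul' c p := by
    symm
    refine eq_fieldL2 hA _ ?_
    filter_upwards [Lp.coeFn_smul c (fieldL2 hA (fun i => evalReal (p i)) fun i =>
      continuous_evalReal (p i)), coeFn_fieldL2 hA fun i => continuous_evalReal (p i)] with x hx hp
    rw [RingHom.id_apply, hx, Pi.smul_apply, hp]
    ext i
    simp [vecField, evalReal]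

theorem coeFn_polyL2 (p : Fin 3 → MvPolynomial (Fin 3) ℂ) :
    ⇑(polyL2 hA p) =ᵐ[ellipsoidMeasure A] polyField p :=
  coeFn_fieldL2 hA fun i => continuous_evalReal (p i)

theorem eq_polyL2 {u : L2Fields A} {p : Fin 3 → MvPolynomial (Fin 3) ℂ}
    (hu : ⇑u =ᵐ[ellipsoidMeasure A] polyField p) : u = polyL2 hA p :=
  eq_fieldL2 hA (fun i => continuous_evalReal (p i)) hu

theorem polyL2_mem_polyFields {n : ℕ} {p : Fin 3 → MvPolynomial (Fin 3) ℂ}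
    (hp : ∀ i, (p i).totalDegree ≤ n) : polyL2 hA p ∈ polyFields A n :=
  ⟨p, hp, coeFn_polyL2 hA p⟩

theorem polyL2_mem_solenoidal {p : Fin 3 → MvPolynomial (Fin 3) ℂ} (hdiv : DivFree p)
    (htan : TangentToBoundary A p) : polyL2 hA p ∈ solenoidal A :=
  fieldL2_mem_solenoidal hA (fun i => contDiff_evalReal (p i))
    (fun x => by
      rw [divergence_evalReal, show ∑ i, MvPolynomial.pderiv i (p i) = 0 from hdiv]
      simp [evalReal]) htan

theorem orthogonalToPolyGrads_of_mem_solenoidal (n : ℕ) {p : Fin 3 → MvPolynomial (Fin 3) ℂ}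
    (h : polyL2 hA p ∈ solenoidal A) : OrthogonalToPolyGrads A n p := by
  intro φ _
  simpa only [partialDeriv_evalReal] using
    (fieldL2_mem_solenoidal_iff hA fun i => continuous_evalReal (p i)).1 h (evalReal φ)
      (contDiff_evalReal φ)

include hA in
theorem mem_polySolenoidal_iff (n : ℕ) (u : L2Fields A) : u ∈ polySolenoidal A n ↔
    ∃ p : Fin 3 → MvPolynomial (Fin 3) ℂ, (∀ i, (p i).totalDegree ≤ n) ∧
      ⇑u =ᵐ[ellipsoidMeasure A] polyField p ∧ DivFree p ∧ TangentToBoundary A p := by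
  constructor
  · rintro ⟨⟨p, hp, hu⟩, hs⟩
    rw [SetLike.mem_coe, eq_polyL2 hA hu] at hs
    have ho := orthogonalToPolyGrads_of_mem_solenoidal hA n hs
    exact ⟨p, hp, hu, ho.divFree hA hp, ho.tangentToBoundary hA hp⟩
  · rintro ⟨p, hp, hu, hdiv, htan⟩
    refine ⟨⟨p, hp, hu⟩, ?_⟩
    rw [SetLike.mem_coe, eq_polyL2 hA hu]
    exact polyL2_mem_solenoidal hA hdiv htan

/-! ### The Leray projector preserves the polynomial fields -/

/-- The gradient of a polynomial, as an element of `L²`. -/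
def polyGradL2 : MvPolynomial (Fin 3) ℂ →ₗ[ℂ] L2Fields A :=
  polyL2 hA ∘ₗ LinearMap.pi fun i => (MvPolynomial.pderiv i).toLinearMap

theorem polyGradL2_mem_smoothGradients (φ : MvPolynomial (Fin 3) ℂ) :
    polyGradL2 hA φ ∈ smoothGradients A := by
  refine ⟨evalReal φ, contDiff_evalReal φ, (coeFn_polyL2 hA _).trans ?_⟩
  rw [gradField_eq_vecField, polyField_eq_vecField]
  simp only [partialDeriv_evalReal]
  rfl

include hA in
/-- If `∇φ` is the projection of the polynomial field `w` of degree `n` on the finite dimensional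
space of the gradients of the polynomials of degree at most `n + 1`, the field `w - ∇φ` is
orthogonal to these gradients, and so to all gradients. -/
theorem leray_mem_polySolenoidal {n : ℕ} {w : L2Fields A} (hw : w ∈ polyFields A n) :
    (leray A w : L2Fields A) ∈ polySolenoidal A n := by
  obtain ⟨p, hp, hwp⟩ := hw
  obtain rfl := eq_polyL2 hA hwp
  set G := (MvPolynomial.restrictTotalDegree (Fin 3) ℂ (n + 1)).map (polyGradL2 hA) with hG
  obtain ⟨φ, hφ, hφg⟩ : G.starProjection (polyL2 hA p) ∈ G := Submodule.starProjection_apply_mem _ _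
  rw [SetLike.mem_coe, MvPolynomial.mem_restrictTotalDegree] at hφ
  have horth := G.sub_starProjection_mem_orthogonal (polyL2 hA p)
  rw [← hφg] at horth
  set q : Fin 3 → MvPolynomial (Fin 3) ℂ := p - fun i => MvPolynomial.pderiv i φ with hq
  have hqe : polyL2 hA p - polyGradL2 hA φ = polyL2 hA q := by
    rw [hq, map_sub]
    rfl
  have hqdeg : ∀ i, (q i).totalDegree ≤ n := fun i =>
    (MvPolynomial.totalDegree_sub _ _).trans (max_le (hp i)
      ((totalDegree_pderiv_le i φ).trans (by omega)))
  rw [hqe] at horth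
  have ho : OrthogonalToPolyGrads A n q := by
    intro ψ hψ
    have := (Submodule.mem_orthogonal G _).1 horth (polyGradL2 hA ψ)
      (Submodule.mem_map_of_mem ((MvPolynomial.mem_restrictTotalDegree _ _ _).2 hψ))
    exact (inner_fieldL2 hA (fun i => continuous_evalReal (MvPolynomial.pderiv i ψ))
      fun i => continuous_evalReal (q i)).symm.trans this
  have hqs := polyL2_mem_solenoidal hA (ho.divFree hA hqdeg) (ho.tangentToBoundary hA hqdeg)
  have hgrad : polyGradL2 hA φ ∈ (solenoidal A)ᗮ :=
    Submodule.le_orthogonal_orthogonal _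
      (Submodule.subset_span (polyGradL2_mem_smoothGradients hA φ))
  have hproj : (solenoidal A).starProjection (polyL2 hA p) = polyL2 hA q :=
    (Submodule.eq_starProjection_of_mem_orthogonal hqs (by
      rw [← hqe, sub_sub_cancel]
      exact hgrad))
  change (solenoidal A).starProjection (polyL2 hA p) ∈ _
  rw [hproj]
  exact ⟨polyL2_mem_polyFields hA hqdeg, hqs⟩

theorem crossMap_apply (Ω : R3) (v : C3) (i : Fin 3) :
    crossMap Ω v i = crossProduct (fun i => (Ω i : ℂ)) (WithLp.ofLp v) i := rfl

theorem coeFn_crossOp (A : Fin 3 → ℝ) (Ω : R3) (u : L2Fields A) :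
    ⇑(crossOp A Ω u) =ᵐ[ellipsoidMeasure A] fun x => crossMap Ω (u x) :=
  ContinuousLinearMap.coeFn_compLpL _ _

theorem crossOp_mem_polyFields (A : Fin 3 → ℝ) (Ω : R3) {n : ℕ} {u : L2Fields A}
    (hu : u ∈ polyFields A n) : crossOp A Ω u ∈ polyFields A n := by
  obtain ⟨p, hp, hup⟩ := hu
  have hdeg : ∀ (a b : ℂ) (j k : Fin 3),
      (MvPolynomial.C a * p j - MvPolynomial.C b * p k).totalDegree ≤ n := by
    intro a b j k
    refine (MvPolynomial.totalDegree_sub _ _).trans (max_le ?_ ?_) <;>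
    · refine (MvPolynomial.totalDegree_mul _ _).trans ?_
      rw [MvPolynomial.totalDegree_C, zero_add]
      exact hp _
  refine ⟨crossProduct (fun i => MvPolynomial.C (Ω i : ℂ)) p, fun i => ?_, ?_⟩
  · rw [cross_apply]
    fin_cases i <;> exact hdeg _ _ _ _
  · filter_upwards [coeFn_crossOp A Ω u, hup] with x h1 h2
    rw [h1, h2]
    ext i
    rw [crossMap_apply]
    simp only [cross_apply, polyField]
    fin_cases i <;> simp

include hA in
theorem poincareOp_mem_polySolenoidal (Ω : R3) {n : ℕ} {u : solenoidal A}
    (hu : (u : L2Fields A) ∈ polySolenoidal A n) :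
    (poincareOp A Ω u : L2Fields A) ∈ polySolenoidal A n :=
  Submodule.smul_mem _ Complex.I
    (leray_mem_polySolenoidal hA (crossOp_mem_polyFields A Ω hu.1))

/-! ### Density of the polynomial fields -/

theorem conj_evalReal (p : MvPolynomial (Fin 3) ℂ) (x : R3) :
    conj (evalReal p x) = evalReal (MvPolynomial.map (starRingEnd ℂ) p) x := by
  induction p using MvPolynomial.induction_on with
  | C a => simp [evalReal_C]
  | add p q hp hq => simp [evalReal_add, hp, hq]
  | mul_X p j hp => simp [evalReal_mul_X, hp]

/-- The continuous functions on a subset of `ℝ³` which are given by polynomials. -/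
def polyFunctions (K : Set R3) : StarSubalgebra ℂ C(K, ℂ) where
  carrier := {f | ∃ p, ∀ x : K, f x = evalReal p x}
  mul_mem' := by
    rintro f g ⟨p, hp⟩ ⟨q, hq⟩
    exact ⟨p * q, fun x => by simp [hp x, hq x, evalReal]⟩
  add_mem' := by
    rintro f g ⟨p, hp⟩ ⟨q, hq⟩
    exact ⟨p + q, fun x => by simp [hp x, hq x, evalReal]⟩
  algebraMap_mem' c := ⟨MvPolynomial.C c, fun x => by simp [evalReal]⟩
  star_mem' := by
    rintro f ⟨p, hp⟩
    exact ⟨MvPolynomial.map (starRingEnd ℂ) p, fun x => by simp [hp x, ← conj_evalReal]⟩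

theorem separatesPoints_polyFunctions (K : Set R3) : (polyFunctions K).SeparatesPoints := by
  intro x y hxy
  obtain ⟨i, hi⟩ : ∃ i, (x : R3) i ≠ (y : R3) i := by
    by_contra! h
    exact hxy (Subtype.ext (PiLp.ext h))
  refine ⟨fun z => evalReal (MvPolynomial.X i) z, ⟨⟨fun z : K => evalReal (MvPolynomial.X i) z,
    (continuous_evalReal _).comp continuous_subtype_val⟩, ⟨_, fun _ => rfl⟩, rfl⟩, ?_⟩
  simpa [evalReal] using hi

/-- Weierstrass approximation on a compact set. -/
theorem exists_evalReal_near {K : Set R3} (hK : IsCompact K) {g : R3 → ℂ} (hg : Continuous g)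
    {ε : ℝ} (hε : 0 < ε) : ∃ p, ∀ x ∈ K, ‖g x - evalReal p x‖ ≤ ε := by
  have := isCompact_iff_compactSpace.1 hK
  have htop := ContinuousMap.starSubalgebra_topologicalClosure_eq_top_of_separatesPoints
    (polyFunctions K) (separatesPoints_polyFunctions K)
  set f : C(K, ℂ) := ⟨fun x => g x, hg.comp continuous_subtype_val⟩
  have hf : f ∈ closure (polyFunctions K : Set C(K, ℂ)) := by
    rw [← StarSubalgebra.topologicalClosure_coe, htop]
    trivial
  obtain ⟨h, ⟨p, hp⟩, hd⟩ := Metric.mem_closure_iff.1 hf ε hε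
  refine ⟨p, fun x hx => ?_⟩
  have h1 := (ContinuousMap.dist_apply_le_dist (f := f) (g := h) ⟨x, hx⟩).trans hd.le
  rwa [hp, dist_eq_norm] at h1

theorem denseRange_polyL2 : DenseRange (polyL2 hA) := by
  have := isFiniteMeasure_ellipsoidMeasure hA
  intro f
  rw [Metric.mem_closure_range_iff]
  intro ε hε
  obtain ⟨g, -, hfg, hgc, -⟩ := (Lp.memLp f).exists_hasCompactSupport_eLpNorm_sub_le
    ENNReal.ofNat_ne_top (ε := ENNReal.ofReal (ε / 3)) (by simpa using hε)
  set K := (ellipsoidMeasure A).real Set.univ ^ (1 / 2 : ℝ) with hK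
  have hK0 : 0 ≤ K := Real.rpow_nonneg measureReal_nonneg _
  set η := ε / (9 * (K + 1)) with hη
  have hη0 : 0 < η := by positivity
  have hgi : ∀ i, Continuous fun x => g x i := fun i =>
    (EuclideanSpace.proj (𝕜 := ℂ) i).continuous.comp hgc
  choose p hp using fun i => exists_evalReal_near (isCompact_ellipsoid hA) (hgi i) hη0
  refine ⟨p, ?_⟩
  set u := fieldL2 hA (fun i x => g x i) hgi with hu
  have hdiff : u - polyL2 hA p = fieldL2 hA (fun i x => g x i - evalReal (p i) x)
      (fun i => (hgi i).sub (continuous_evalReal _)) := by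
    refine eq_fieldL2 hA _ ?_
    filter_upwards [Lp.coeFn_sub u (polyL2 hA p), coeFn_fieldL2 hA hgi, coeFn_polyL2 hA p]
      with x h1 h2 h3
    rw [h1, Pi.sub_apply, h2, h3]
    rfl
  have h1 : ‖u - polyL2 hA p‖ ≤ K * (3 * η) := by
    rw [hdiff]
    refine norm_fieldL2_le hA _ (by positivity) fun x hx => ?_
    refine (norm_le_sum_norm _).trans ?_
    calc ∑ i, ‖vecField (fun i x => g x i - evalReal (p i) x) x i‖ ≤ ∑ _i : Fin 3, η :=
          Finset.sum_le_sum fun i _ => hp i x hx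
      _ = 3 * η := by simp
  have h2 : ‖f - u‖ ≤ ε / 3 := by
    have hae : ⇑(f - u) =ᵐ[ellipsoidMeasure A] ⇑f - g := by
      filter_upwards [Lp.coeFn_sub f u, coeFn_fieldL2 hA hgi] with x h1 h2
      rw [h1, Pi.sub_apply, h2]
      rfl
    rw [Lp.norm_def, eLpNorm_congr_ae hae]
    exact ENNReal.toReal_le_of_le_ofReal (by positivity) hfg
  have h3 : K * (3 * η) ≤ ε / 3 := by
    rw [hη, show K * (3 * (ε / (9 * (K + 1)))) = ε / 3 * (K / (K + 1)) by field_simp; norm_num]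
    refine mul_le_of_le_one_right (by positivity) ?_
    rw [div_le_one (by positivity)]
    linarith
  rw [dist_eq_norm]
  calc ‖f - polyL2 hA p‖ = ‖(f - u) + (u - polyL2 hA p)‖ := by rw [sub_add_sub_cancel]
    _ ≤ ‖f - u‖ + ‖u - polyL2 hA p‖ := norm_add_le _ _
    _ < ε := by linarith

end

/-! ### Symmetric operators with a dense union of finite dimensional invariant subspaces -/

section Abstract

variable {H : Type*} [NormedAddCommGroup H] [InnerProductSpace ℂ H]

/-- The space preceding `W n` in the sequence `⊥, W 0, W 1, …`. -/
def precedingSubspace (W : ℕ → Submodule ℂ H) : ℕ → Submodule ℂ H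
  | 0 => ⊥
  | n + 1 => W n

/-- The orthogonal complement in `W n` of the preceding space. -/
def gradedPiece (W : ℕ → Submodule ℂ H) (n : ℕ) : Submodule ℂ H :=
  W n ⊓ (precedingSubspace W n)ᗮ

variable {W : ℕ → Submodule ℂ H}

theorem le_precedingSubspace (hmono : Monotone W) {m n : ℕ} (h : m < n) :
    W m ≤ precedingSubspace W n := by
  cases n with
  | zero => omega
  | succ n => exact hmono (Nat.lt_succ_iff.1 h)

theorem orthogonalFamily_gradedPiece (hmono : Monotone W) :
    OrthogonalFamily ℂ (fun n => gradedPiece W n) fun n => (gradedPiece W n).subtypeₗᵢ := by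
  have hlt : ∀ m n, m < n → gradedPiece W m ⟂ gradedPiece W n := by
    intro m n h
    have h1 : gradedPiece W m ≤ precedingSubspace W n :=
      inf_le_left.trans (le_precedingSubspace hmono h)
    exact (Submodule.isOrtho_orthogonal_right _).mono h1 inf_le_right
  refine OrthogonalFamily.of_pairwise fun m n hmn => ?_
  rcases hmn.lt_or_gt with h | h
  · exact hlt m n h
  · exact (hlt n m h).symm

theorem le_of_gradedPiece_le [∀ n, FiniteDimensional ℂ (W n)] (hmono : Monotone W)
    {S : Submodule ℂ H} (h : ∀ n, gradedPiece W n ≤ S) (n : ℕ) : W n ≤ S := by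
  induction n with
  | zero =>
    refine le_trans ?_ (h 0)
    simp [gradedPiece, precedingSubspace]
  | succ n ih =>
    rw [← Submodule.sup_orthogonal_inf_of_hasOrthogonalProjection (hmono n.le_succ)]
    refine sup_le ih (le_trans ?_ (h (n + 1)))
    rw [inf_comm]
    rfl

/-- The graded pieces are invariant, and an orthonormal eigenbasis of each of them gives the
basis. (An arbitrary maximal orthonormal family of eigenvectors in `⋃ W n` would not do: it may
fail to be total when an eigenspace has infinite dimension.) -/
theorem exists_hilbertBasis_eigenvectors [CompleteSpace H] {T : H →L[ℂ] H}
    (hT : (T : H →ₗ[ℂ] H).IsSymmetric) [∀ n, FiniteDimensional ℂ (W n)] (hmono : Monotone W)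
    (hinv : ∀ n, ∀ x ∈ W n, T x ∈ W n) (hdense : (⨆ n, W n).topologicalClosure = ⊤) :
    ∃ (ι : Type) (b : HilbertBasis ι ℂ H), ∀ i,
      (∃ μ : ℂ, Module.End.HasEigenvector (T : H →ₗ[ℂ] H) μ (b i)) ∧ ∃ n, b i ∈ W n := by
  have hpre : ∀ n, ∀ x ∈ precedingSubspace W n, T x ∈ precedingSubspace W n := by
    intro n x hx
    cases n with
    | zero =>
      obtain rfl : x = 0 := hx
      simp [precedingSubspace]
    | succ n => exact hinv n x hx
  have hU : ∀ n, ∀ x ∈ gradedPiece W n, (T : H →ₗ[ℂ] H) x ∈ gradedPiece W n := by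
    rintro n x ⟨hx, hx'⟩
    refine ⟨hinv n x hx, (Submodule.mem_orthogonal _ _).2 fun y hy => ?_⟩
    exact (hT y x).symm.trans ((Submodule.mem_orthogonal _ _).1 hx' _ (hpre n y hy))
  have hfin : ∀ n, FiniteDimensional ℂ (gradedPiece W n) := fun n =>
    Submodule.finiteDimensional_inf_left _ _
  have hsym : ∀ n, ((T : H →ₗ[ℂ] H).restrict (hU n)).IsSymmetric := fun n =>
    hT.restrict_invariant (hU n)
  let e : ∀ n, OrthonormalBasis (Fin (Module.finrank ℂ (gradedPiece W n))) ℂ (gradedPiece W n) :=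
    fun n => (hsym n).eigenvectorBasis rfl
  have horth := (orthogonalFamily_gradedPiece hmono).orthonormal_sigma_orthonormal
    (v_family := fun n => e n) fun n => (e n).orthonormal
  set v : (Σ n, Fin (Module.finrank ℂ (gradedPiece W n))) → H := fun a =>
    (gradedPiece W a.1).subtypeₗᵢ (e a.1 a.2) with hv
  have hspan : ∀ n, gradedPiece W n ≤ Submodule.span ℂ (Set.range v) := by
    intro n x hx
    have h1 := (e n).sum_repr ⟨x, hx⟩
    have h2 : x = ∑ i, (e n).repr ⟨x, hx⟩ i • v ⟨n, i⟩ := by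
      conv_lhs => rw [show x = ((⟨x, hx⟩ : gradedPiece W n) : H) from rfl, ← h1]
      simp [hv]
    rw [h2]
    exact Submodule.sum_mem _ fun i _ =>
      Submodule.smul_mem _ _ (Submodule.subset_span ⟨_, rfl⟩)
  have htop : ⊤ ≤ (Submodule.span ℂ (Set.range v)).topologicalClosure := by
    rw [← hdense]
    exact Submodule.topologicalClosure_mono (iSup_le (le_of_gradedPiece_le hmono hspan))
  refine ⟨_, HilbertBasis.mk horth htop, fun a => ?_⟩
  rw [HilbertBasis.coe_mk]
  have hev := (hsym a.1).hasEigenvector_eigenvectorBasis rfl a.2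
  refine ⟨⟨_, Module.End.mem_eigenspace_iff.2 (congrArg Subtype.val hev.apply_eq_smul), ?_⟩,
    a.1, (e a.1 a.2).2.1⟩
  exact fun h => hev.2 (Subtype.ext h)

theorem hasPurePointSpectrum_of_hilbertBasis {ι : Type*} {T : H →L[ℂ] H}
    (b : HilbertBasis ι ℂ H)
    (hb : ∀ i, ∃ μ : ℂ, Module.End.HasEigenvector (T : H →ₗ[ℂ] H) μ (b i)) :
    HasPurePointSpectrum T := by
  rw [HasPurePointSpectrum, eq_top_iff, ← b.dense_span]
  refine Submodule.topologicalClosure_mono (Submodule.span_le.2 ?_)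
  rintro _ ⟨i, rfl⟩
  obtain ⟨μ, hμ⟩ := hb i
  exact Submodule.mem_iSup_of_mem μ hμ.1

theorem spectrum_subset_of_isSelfAdjoint [CompleteSpace H] {T : H →L[ℂ] H} (hT : IsSelfAdjoint T)
    {r : ℝ} (hr : ‖T‖ ≤ r) : spectrum ℂ T ⊆ Complex.ofReal '' Set.Icc (-r) r := by
  intro z hz
  have h1 : ‖z‖ ≤ r := by
    calc ‖z‖ ≤ ‖T‖ * ‖(1 : H →L[ℂ] H)‖ := spectrum.norm_le_norm_mul_of_mem hz
      _ ≤ r * 1 := mul_le_mul hr ContinuousLinearMap.norm_id_le (norm_nonneg _)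
          ((norm_nonneg _).trans hr)
      _ = r := mul_one _
  exact ⟨z.re, abs_le.1 ((Complex.abs_re_le_norm z).trans h1), (hT.mem_spectrum_eq_re hz).symm⟩

/-- **Weyl's criterion**: approximate eigenvectors which do not tend to zero detect a point of the
spectrum. -/
theorem mem_spectrum_of_approx {T : H →L[ℂ] H} {μ : ℂ} {v : ℕ → H} {c : ℝ} (hc : 0 < c)
    (hv : ∀ᶠ n in Filter.atTop, c ≤ ‖v n‖)
    (hT : Filter.Tendsto (fun n => T (v n) - μ • v n) Filter.atTop (nhds 0)) :
    μ ∈ spectrum ℂ T := by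
  intro hu
  obtain ⟨S, hS⟩ := hu.exists_left_inv
  have hS' : ∀ n, v n = -S (T (v n) - μ • v n) := by
    intro n
    have := congrArg (fun R : H →L[ℂ] H => R (v n)) hS
    have h1 : S (μ • v n - T (v n)) = v n := by
      simpa [Algebra.algebraMap_eq_smul_one] using this
    rw [← map_neg, neg_sub, h1]
  have hlim : Filter.Tendsto v Filter.atTop (nhds 0) := by
    have := ((S.continuous.tendsto 0).comp hT).neg
    rw [map_zero, neg_zero] at this
    exact this.congr fun n => (hS' n).symm
  have h1 : ∀ᶠ n in Filter.atTop, ‖v n‖ < c := by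
    have := hlim.norm
    rw [norm_zero] at this
    exact this.eventually (gt_mem_nhds hc)
  obtain ⟨n, h2, h3⟩ := (hv.and h1).exists
  linarith

end Abstract

/-! ### The Poincaré operator is selfadjoint, with norm at most `‖Ω‖` -/

theorem inner_crossMap (Ω : R3) (v w : C3) : ⟪crossMap Ω v, w⟫_ℂ = -⟪v, crossMap Ω w⟫_ℂ := by
  simp only [PiLp.inner_apply, RCLike.inner_apply, crossMap_apply, cross_apply, Fin.sum_univ_three]
  simp
  ring

theorem norm_crossMap_apply_le (Ω : R3) (v : C3) : ‖crossMap Ω v‖ ≤ ‖Ω‖ * ‖v‖ := by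
  refine le_of_sq_le_sq ?_ (by positivity)
  rw [mul_pow, EuclideanSpace.norm_sq_eq, EuclideanSpace.norm_sq_eq, EuclideanSpace.norm_sq_eq]
  simp only [crossMap_apply, cross_apply, Fin.sum_univ_three, Complex.sq_norm,
    Complex.normSq_apply, Real.norm_eq_abs, sq_abs]
  simp
  -- the difference is the squared modulus of `Ω · v`
  nlinarith [sq_nonneg (Ω 0 * (v 0).re + Ω 1 * (v 1).re + Ω 2 * (v 2).re),
    sq_nonneg (Ω 0 * (v 0).im + Ω 1 * (v 1).im + Ω 2 * (v 2).im)]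

theorem norm_crossOp_le (A : Fin 3 → ℝ) (Ω : R3) : ‖crossOp A Ω‖ ≤ ‖Ω‖ :=
  (ContinuousLinearMap.norm_compLpL_le _).trans
    ((crossMap Ω).opNorm_le_bound (norm_nonneg _) (norm_crossMap_apply_le Ω))

theorem inner_crossOp (A : Fin 3 → ℝ) (Ω : R3) (u v : L2Fields A) :
    ⟪crossOp A Ω u, v⟫_ℂ = -⟪u, crossOp A Ω v⟫_ℂ := by
  rw [L2.inner_def, L2.inner_def, ← integral_neg]
  refine integral_congr_ae ?_
  filter_upwards [coeFn_crossOp A Ω u, coeFn_crossOp A Ω v] with x h1 h2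
  rw [h1, h2, inner_crossMap]

theorem poincareOp_apply (A : Fin 3 → ℝ) (Ω : R3) (u : solenoidal A) :
    poincareOp A Ω u = Complex.I • leray A (crossOp A Ω u) := rfl

theorem isSymmetric_poincareOp (A : Fin 3 → ℝ) (Ω : R3) :
    (poincareOp A Ω : solenoidal A →ₗ[ℂ] solenoidal A).IsSymmetric := by
  intro u v
  change ⟪Complex.I • (leray A (crossOp A Ω u) : L2Fields A), (v : L2Fields A)⟫_ℂ =
    ⟪(u : L2Fields A), Complex.I • (leray A (crossOp A Ω v) : L2Fields A)⟫_ℂ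
  have h1 : ⟪(leray A (crossOp A Ω u) : L2Fields A), (v : L2Fields A)⟫_ℂ =
      ⟪crossOp A Ω u, (v : L2Fields A)⟫_ℂ :=
    (solenoidal A).inner_orthogonalProjectionOnto_eq_of_mem_right v (crossOp A Ω u)
  have h2 : ⟪(u : L2Fields A), (leray A (crossOp A Ω v) : L2Fields A)⟫_ℂ =
      ⟪(u : L2Fields A), crossOp A Ω v⟫_ℂ :=
    (solenoidal A).inner_orthogonalProjectionOnto_eq_of_mem_left u (crossOp A Ω v)
  rw [inner_smul_left, inner_smul_right, h1, h2, inner_crossOp]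
  simp

theorem isSelfAdjoint_poincareOp (A : Fin 3 → ℝ) (Ω : R3) : IsSelfAdjoint (poincareOp A Ω) :=
  ContinuousLinearMap.isSelfAdjoint_iff_isSymmetric.2 (isSymmetric_poincareOp A Ω)

theorem norm_poincareOp_le (A : Fin 3 → ℝ) (Ω : R3) : ‖poincareOp A Ω‖ ≤ ‖Ω‖ := by
  refine ContinuousLinearMap.opNorm_le_bound _ (norm_nonneg _) fun u => ?_
  rw [poincareOp_apply, norm_smul, Complex.norm_I, one_mul]
  calc ‖leray A (crossOp A Ω u)‖ ≤ ‖crossOp A Ω u‖ :=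
        (solenoidal A).norm_orthogonalProjectionOnto_apply_le _
    _ ≤ ‖crossOp A Ω‖ * ‖(u : L2Fields A)‖ := (crossOp A Ω).le_opNorm _
    _ ≤ ‖Ω‖ * ‖u‖ := by
        rw [Submodule.coe_norm]
        gcongr
        exact norm_crossOp_le A Ω

theorem spectrum_poincareOp_subset (A : Fin 3 → ℝ) (Ω : R3) :
    spectrum ℂ (poincareOp A Ω) ⊆ Complex.ofReal '' Set.Icc (-‖Ω‖) ‖Ω‖ :=
  spectrum_subset_of_isSelfAdjoint (isSelfAdjoint_poincareOp A Ω) (norm_poincareOp_le A Ω)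

/-! ### The eigenbasis -/

section

variable {A : Fin 3 → ℝ} (hA : ∀ i, 0 < A i)

/-- The space `𝒱ₙ⁰`, as a subspace of `𝒱⁰`. -/
def polySubspace (A : Fin 3 → ℝ) (n : ℕ) : Submodule ℂ (solenoidal A) :=
  (polyFields A n).comap (solenoidal A).subtype

include hA in
theorem finiteDimensional_polyFields (n : ℕ) : FiniteDimensional ℂ (polyFields A n) := by
  let f : (Fin 3 → MvPolynomial.restrictTotalDegree (Fin 3) ℂ n) →ₗ[ℂ] L2Fields A :=
    polyL2 hA ∘ₗ LinearMap.pi fun i => Submodule.subtype _ ∘ₗ LinearMap.proj i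
  have hle : polyFields A n ≤ LinearMap.range f := by
    rintro u ⟨p, hp, hu⟩
    exact ⟨fun i => ⟨p i, (MvPolynomial.mem_restrictTotalDegree _ _ _).2 (hp i)⟩,
      (eq_polyL2 hA hu).symm⟩
  exact Submodule.finiteDimensional_of_le hle

include hA in
theorem finiteDimensional_polySubspace (n : ℕ) : FiniteDimensional ℂ (polySubspace A n) := by
  have := finiteDimensional_polyFields hA n
  let f : polySubspace A n →ₗ[ℂ] polyFields A n :=
    ((solenoidal A).subtype ∘ₗ (polySubspace A n).subtype).codRestrict _ fun u => u.2
  refine FiniteDimensional.of_injective f fun u v h => ?_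
  exact Subtype.ext (Subtype.ext (congrArg (fun w : polyFields A n => (w : L2Fields A)) h))

theorem monotone_polySubspace (A : Fin 3 → ℝ) : Monotone (polySubspace A) := by
  rintro m n hmn u ⟨p, hp, hu⟩
  exact ⟨p, fun i => (hp i).trans hmn, hu⟩

include hA in
theorem dense_polySubspace : (⨆ n, polySubspace A n).topologicalClosure = ⊤ := by
  have hsurj : Function.Surjective (leray A) := fun v =>
    ⟨v, (solenoidal A).orthogonalProjectionOnto_mem_subspace_eq_self v⟩
  have hd : DenseRange fun p => leray A (polyL2 hA p) :=
    hsurj.denseRange.comp (denseRange_polyL2 hA) (leray A).continuous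
  refine Submodule.dense_iff_topologicalClosure_eq_top.1 (hd.mono ?_)
  rintro _ ⟨p, rfl⟩
  set n := Finset.univ.sup fun i => (p i).totalDegree with hn
  have hp : polyL2 hA p ∈ polyFields A n := polyL2_mem_polyFields hA fun i =>
    Finset.le_sup (f := fun i => (p i).totalDegree) (Finset.mem_univ i)
  exact Submodule.mem_iSup_of_mem (p := polySubspace A) n (leray_mem_polySolenoidal hA hp).1

include hA in
theorem exists_poly_eigenbasis (Ω : R3) :
    ∃ (ι : Type) (b : HilbertBasis ι ℂ (solenoidal A)), ∀ i : ι,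
      (∃ μ : ℂ, Module.End.HasEigenvector
        (poincareOp A Ω : solenoidal A →ₗ[ℂ] solenoidal A) μ (b i)) ∧
      ∃ n : ℕ, (b i : L2Fields A) ∈ polyFields A n := by
  have := finiteDimensional_polySubspace hA
  exact exists_hilbertBasis_eigenvectors (isSymmetric_poincareOp A Ω) (monotone_polySubspace A)
    (fun n u hu => (poincareOp_mem_polySolenoidal hA Ω ⟨hu, u.2⟩).1) (dense_polySubspace hA)

end

/-! ### Polarised plane waves -/

theorem exists_unit_vector_inner_eq (Ω : R3) {r : ℝ} (hr : r ∈ Set.Icc (-‖Ω‖) ‖Ω‖) :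
    ∃ ξ : R3, ‖ξ‖ = 1 ∧ ⟪Ω, ξ⟫_ℝ = r := by
  rcases eq_or_ne Ω 0 with rfl | hΩ
  · refine ⟨EuclideanSpace.single 0 1, by simp, ?_⟩
    simp only [norm_zero, neg_zero, Set.Icc_self, Set.mem_singleton_iff] at hr
    rw [hr, inner_zero_left]
  have hΩ' : ‖Ω‖ ≠ 0 := norm_ne_zero_iff.2 hΩ
  have hs : IsPreconnected (Metric.sphere (0 : R3) 1) :=
    isPreconnected_sphere (by
      rw [← Module.finrank_eq_rank, finrank_euclideanSpace, Fintype.card_fin]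
      norm_num) 0 1
  have hu : ‖‖Ω‖⁻¹ • Ω‖ = 1 := by
    rw [norm_smul, norm_inv, norm_norm, inv_mul_cancel₀ hΩ']
  have hinner : ⟪Ω, ‖Ω‖⁻¹ • Ω⟫_ℝ = ‖Ω‖ := by
    rw [real_inner_smul_right, real_inner_self_eq_norm_sq]
    field_simp
  have hiv := hs.intermediate_value (a := -(‖Ω‖⁻¹ • Ω)) (b := ‖Ω‖⁻¹ • Ω)
    (f := fun ξ => ⟪Ω, ξ⟫_ℝ) (by simpa using hu) (by simpa using hu)
    (continuous_const.inner continuous_id).continuousOn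
  simp only [inner_neg_right, hinner] at hiv
  obtain ⟨ξ, hξ, h⟩ := hiv hr
  exact ⟨ξ, by simpa using hξ, h⟩

theorem exists_orthogonal_ne_zero (ξ : R3) :
    ∃ e : Fin 3 → ℝ, e ≠ 0 ∧ ξ 0 * e 0 + ξ 1 * e 1 + ξ 2 * e 2 = 0 := by
  by_cases h : ξ 0 = 0
  · exact ⟨![1, 0, 0], fun h0 => by simpa using congrFun h0 0, by simp [h]⟩
  · exact ⟨![-ξ 1, ξ 0, 0], fun h0 => h (by simpa using congrFun h0 1), by simp; ring⟩

/-- One component of `i Ω ∧ a - r a = i (ξ · (Ω ∧ a)) ξ`; the others follow by cyclic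
permutation of the coordinates. -/
theorem cross_sub_component {ξ₀ ξ₁ ξ₂ Ω₀ Ω₁ Ω₂ a₀ a₁ a₂ r : ℂ}
    (hξ : ξ₀ * ξ₀ + ξ₁ * ξ₁ + ξ₂ * ξ₂ = 1) (hr : Ω₀ * ξ₀ + Ω₁ * ξ₁ + Ω₂ * ξ₂ = r)
    (ha : ξ₀ * a₀ + ξ₁ * a₁ + ξ₂ * a₂ = 0) (h₀ : ξ₁ * a₂ - ξ₂ * a₁ = -Complex.I * a₀) :
    Complex.I * (Ω₁ * a₂ - Ω₂ * a₁) - r * a₀ =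
      Complex.I * (ξ₀ * (Ω₁ * a₂ - Ω₂ * a₁) + ξ₁ * (Ω₂ * a₀ - Ω₀ * a₂) +
        ξ₂ * (Ω₀ * a₁ - Ω₁ * a₀)) * ξ₀ := by
  linear_combination (-Complex.I * (Ω₁ * a₂ - Ω₂ * a₁)) * hξ -
    Complex.I * (ξ₁ * Ω₂ - ξ₂ * Ω₁) * ha +
    Complex.I * (Ω₀ * ξ₀ + Ω₁ * ξ₁ + Ω₂ * ξ₂) * h₀ + a₀ * hr -
    ((Ω₀ * ξ₀ + Ω₁ * ξ₁ + Ω₂ * ξ₂) * a₀) * Complex.I_sq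

/-- For each `r ∈ [-‖Ω‖, ‖Ω‖]` there is a direction `ξ` and a circular polarisation `a`,
orthogonal to `ξ`, for which `i Ω ∧ a - r a` is parallel to `ξ`: the wave `exp (i t ξ · x) a` is a
solution of the eigenvalue equation up to a gradient. -/
theorem exists_polarisation (Ω : R3) {r : ℝ} (hr : r ∈ Set.Icc (-‖Ω‖) ‖Ω‖) :
    ∃ (ξ : R3) (a : Fin 3 → ℂ) (κ : ℂ), a ≠ 0 ∧
      (fun i => (ξ i : ℂ)) ⨯₃ a = -Complex.I • a ∧ ∑ i, (ξ i : ℂ) * a i = 0 ∧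
      ∀ i, Complex.I * ((fun i => (Ω i : ℂ)) ⨯₃ a) i - r * a i = κ * ξ i := by
  obtain ⟨ξ, hξ, hΩξ⟩ := exists_unit_vector_inner_eq Ω hr
  obtain ⟨e, he, hξe⟩ := exists_orthogonal_ne_zero ξ
  have hξ2 : ξ 0 * ξ 0 + ξ 1 * ξ 1 + ξ 2 * ξ 2 = 1 := by
    have := EuclideanSpace.norm_sq_eq ξ
    rw [hξ, Fin.sum_univ_three] at this
    simp only [Real.norm_eq_abs, sq_abs] at this
    linarith
  have hr2 : Ω 0 * ξ 0 + Ω 1 * ξ 1 + Ω 2 * ξ 2 = r := by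
    rw [← hΩξ, PiLp.inner_apply, Fin.sum_univ_three]
    simp only [RCLike.inner_apply, conj_trivial]
    ring
  have hξ3 : (ξ 0 : ℂ) * ξ 0 + ξ 1 * ξ 1 + ξ 2 * ξ 2 = 1 := by
    simpa using congrArg Complex.ofReal hξ2
  have hr3 : (Ω 0 : ℂ) * ξ 0 + Ω 1 * ξ 1 + Ω 2 * ξ 2 = r := by
    simpa using congrArg Complex.ofReal hr2
  have hξe3 : (ξ 0 : ℂ) * e 0 + ξ 1 * e 1 + ξ 2 * e 2 = 0 := by
    simpa using congrArg Complex.ofReal hξe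
  set a : Fin 3 → ℂ := ![e 0 + Complex.I * (ξ 1 * e 2 - ξ 2 * e 1),
    e 1 + Complex.I * (ξ 2 * e 0 - ξ 0 * e 2), e 2 + Complex.I * (ξ 0 * e 1 - ξ 1 * e 0)] with ha
  have a0 : a 0 = e 0 + Complex.I * (ξ 1 * e 2 - ξ 2 * e 1) := rfl
  have a1 : a 1 = e 1 + Complex.I * (ξ 2 * e 0 - ξ 0 * e 2) := rfl
  have a2 : a 2 = e 2 + Complex.I * (ξ 0 * e 1 - ξ 1 * e 0) := rfl
  have hdot : (ξ 0 : ℂ) * a 0 + ξ 1 * a 1 + ξ 2 * a 2 = 0 := by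
    rw [a0, a1, a2]
    linear_combination hξe3
  have c0 : (ξ 1 : ℂ) * a 2 - ξ 2 * a 1 = -Complex.I * a 0 := by
    rw [a0, a1, a2]
    linear_combination (Complex.I * ξ 0) * hξe3 - (Complex.I * e 0) * hξ3 +
      (ξ 1 * e 2 - ξ 2 * e 1) * Complex.I_sq
  have c1 : (ξ 2 : ℂ) * a 0 - ξ 0 * a 2 = -Complex.I * a 1 := by
    rw [a0, a1, a2]
    linear_combination (Complex.I * ξ 1) * hξe3 - (Complex.I * e 1) * hξ3 +
      (ξ 2 * e 0 - ξ 0 * e 2) * Complex.I_sq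
  have c2 : (ξ 0 : ℂ) * a 1 - ξ 1 * a 0 = -Complex.I * a 2 := by
    rw [a0, a1, a2]
    linear_combination (Complex.I * ξ 2) * hξe3 - (Complex.I * e 2) * hξ3 +
      (ξ 0 * e 1 - ξ 1 * e 0) * Complex.I_sq
  refine ⟨ξ, a, Complex.I * (ξ 0 * (Ω 1 * a 2 - Ω 2 * a 1) + ξ 1 * (Ω 2 * a 0 - Ω 0 * a 2) +
    ξ 2 * (Ω 0 * a 1 - Ω 1 * a 0)), ?_, ?_, ?_, ?_⟩
  · intro h
    apply he
    funext i
    have := congrArg Complex.re (congrFun h i)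
    fin_cases i <;> simpa [ha] using this
  · rw [cross_apply]
    funext i
    fin_cases i
    · exact c0
    · exact c1
    · exact c2
  · rw [Fin.sum_univ_three]
    exact hdot
  · intro i
    rw [cross_apply]
    fin_cases i
    · exact cross_sub_component hξ3 hr3 hdot c0
    · refine (cross_sub_component (ξ₀ := ξ 1) (ξ₁ := ξ 2) (ξ₂ := ξ 0) (Ω₀ := Ω 1) (Ω₁ := Ω 2)
        (Ω₂ := Ω 0) (a₀ := a 1) (a₁ := a 2) (a₂ := a 0) (r := r) ?_ ?_ ?_ c1).trans ?_
      · linear_combination hξ3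
      · linear_combination hr3
      · linear_combination hdot
      · change _ = _ * (ξ 1 : ℂ)
        ring
    · refine (cross_sub_component (ξ₀ := ξ 2) (ξ₁ := ξ 0) (ξ₂ := ξ 1) (Ω₀ := Ω 2) (Ω₁ := Ω 0)
        (Ω₂ := Ω 1) (a₀ := a 2) (a₁ := a 0) (a₂ := a 1) (r := r) ?_ ?_ ?_ c2).trans ?_
      · linear_combination hξ3
      · linear_combination hr3
      · linear_combination hdot
      · change _ = _ * (ξ 2 : ℂ)
        ring

/-- The plane wave `exp (i t ξ · x)`. -/
def planeWave (ξ : R3) (t : ℝ) (x : R3) : ℂ :=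
  Complex.exp (((t * ∑ j, ξ j * x j : ℝ) : ℂ) * Complex.I)

theorem norm_planeWave (ξ : R3) (t : ℝ) (x : R3) : ‖planeWave ξ t x‖ = 1 :=
  Complex.norm_exp_ofReal_mul_I _

theorem contDiff_planeWave (ξ : R3) (t : ℝ) {n : WithTop ℕ∞} : ContDiff ℝ n (planeWave ξ t) :=
  ((contDiff_ofReal (contDiff_const.mul (ContDiff.sum fun j _ =>
    contDiff_const.mul (contDiff_coord j)))).mul contDiff_const).cexp

theorem partialDeriv_planeWave (ξ : R3) (t : ℝ) (i : Fin 3) (x : R3) :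
    partialDeriv i (planeWave ξ t) x = Complex.I * t * ξ i * planeWave ξ t x := by
  have h1 : HasFDerivAt (fun x : R3 => t * ∑ j, ξ j * x j)
      (t • ∑ j, ξ j • EuclideanSpace.proj (𝕜 := ℝ) j) x :=
    (HasFDerivAt.fun_sum fun j _ => (hasFDerivAt_coord j x).const_mul (ξ j)).const_mul t
  have h2 : HasFDerivAt (fun x : R3 => ((t * ∑ j, ξ j * x j : ℝ) : ℂ))
      (Complex.ofRealCLM.comp (t • ∑ j, ξ j • EuclideanSpace.proj (𝕜 := ℝ) j)) x :=
    Complex.ofRealCLM.hasFDerivAt.comp x h1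
  have h3 : HasFDerivAt (planeWave ξ t) _ x := (h2.mul_const Complex.I).cexp
  rw [partialDeriv, h3.fderiv]
  simp [planeWave]
  ring

/-- The vector `(A₁ x₁, A₂ x₂, A₃ x₃)`, normal to the boundary, with complex entries. -/
def conormal (A : Fin 3 → ℝ) (x : R3) (j : Fin 3) : ℂ := ((A j * x j : ℝ) : ℂ)

/-- The polynomial field `(A x) ∧ a`. -/
def conormalCrossPoly (A : Fin 3 → ℝ) (a : Fin 3 → ℂ) : Fin 3 → MvPolynomial (Fin 3) ℂ :=
  (fun j => MvPolynomial.C (A j : ℂ) * MvPolynomial.X j) ⨯₃ fun k => MvPolynomial.C (a k)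

/-- The amplitude `(1 - quad A) a - (2 / t) (A x) ∧ a`, for which the wave is divergence free and
tangent to the boundary: the wave is the curl of `(1 - quad A) exp (i t ξ · x) a / t`. -/
def amplitude (A : Fin 3 → ℝ) (a : Fin 3 → ℂ) (t : ℝ) (i : Fin 3) : MvPolynomial (Fin 3) ℂ :=
  (1 - quadPoly A) * MvPolynomial.C (a i) - MvPolynomial.C (2 / t : ℂ) * conormalCrossPoly A a i

theorem evalReal_conormalCrossPoly (A : Fin 3 → ℝ) (a : Fin 3 → ℂ) (i : Fin 3) (x : R3) :
    evalReal (conormalCrossPoly A a i) x = (conormal A x ⨯₃ a) i := by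
  fin_cases i <;> simp [conormalCrossPoly, cross_apply, evalReal, conormal]

theorem evalReal_amplitude (A : Fin 3 → ℝ) (a : Fin 3 → ℂ) (t : ℝ) (i : Fin 3) (x : R3) :
    evalReal (amplitude A a t i) x =
      ((1 - quad A x : ℝ) : ℂ) * a i - 2 / t * (conormal A x ⨯₃ a) i := by
  rw [← evalReal_conormalCrossPoly, Complex.ofReal_sub, ← evalReal_quadPoly]
  simp [amplitude, evalReal]

theorem evalReal_pderiv_one_sub_quadPoly (A : Fin 3 → ℝ) (i : Fin 3) (x : R3) :
    evalReal (MvPolynomial.pderiv i (1 - quadPoly A)) x = -2 * conormal A x i := by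
  fin_cases i <;> simp [quadPoly, Fin.sum_univ_three, evalReal, conormal, MvPolynomial.pderiv_X,
    Derivation.leibniz_pow] <;> ring

theorem evalReal_pderiv_amplitude (A : Fin 3 → ℝ) (a : Fin 3 → ℂ) (t : ℝ) (i : Fin 3) (x : R3) :
    evalReal (MvPolynomial.pderiv i (amplitude A a t i)) x = -2 * conormal A x i * a i := by
  have h1 : MvPolynomial.pderiv i (conormalCrossPoly A a i) = 0 := by
    fin_cases i <;> simp [conormalCrossPoly, cross_apply, MvPolynomial.pderiv_X]
  have h2 : MvPolynomial.pderiv i (amplitude A a t i) =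
      MvPolynomial.pderiv i (1 - quadPoly A) * MvPolynomial.C (a i) := by
    rw [amplitude, map_sub, MvPolynomial.pderiv_mul, MvPolynomial.pderiv_mul, h1]
    simp
  rw [h2, ← evalReal_pderiv_one_sub_quadPoly]
  simp [evalReal]

/-- The coefficients of the tangent wave with phase `exp (i t ξ · x)`. -/
def tangentWave (A : Fin 3 → ℝ) (ξ : R3) (a : Fin 3 → ℂ) (t : ℝ) (i : Fin 3) (x : R3) : ℂ :=
  planeWave ξ t x * evalReal (amplitude A a t i) x

theorem contDiff_tangentWave (A : Fin 3 → ℝ) (ξ : R3) (a : Fin 3 → ℂ) (t : ℝ) (i : Fin 3) :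
    ContDiff ℝ 1 (tangentWave A ξ a t i) :=
  (contDiff_planeWave ξ t).mul (contDiff_evalReal _)

theorem tangentWave_tangent (A : Fin 3 → ℝ) (ξ : R3) (a : Fin 3 → ℂ) (t : ℝ) {x : R3}
    (hx : quad A x = 1) : ∑ i, ((A i * x i : ℝ) : ℂ) * tangentWave A ξ a t i x = 0 := by
  change ∑ i, conormal A x i * tangentWave A ξ a t i x = 0
  simp only [tangentWave, evalReal_amplitude, hx, Fin.sum_univ_three, cross_apply]
  simp
  ring

theorem divergence_tangentWave (A : Fin 3 → ℝ) {ξ : R3} {a : Fin 3 → ℂ}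
    (hcross : (fun i => (ξ i : ℂ)) ⨯₃ a = -Complex.I • a) (hdot : ∑ i, (ξ i : ℂ) * a i = 0)
    {t : ℝ} (ht : t ≠ 0) (x : R3) : divergence (tangentWave A ξ a t) x = 0 := by
  have h1 : ∀ i, partialDeriv i (tangentWave A ξ a t i) x =
      planeWave ξ t x * (-2 * conormal A x i * a i) + Complex.I * t * ξ i * planeWave ξ t x *
        (((1 - quad A x : ℝ) : ℂ) * a i - 2 / t * (conormal A x ⨯₃ a) i) := by
    intro i
    have := partialDeriv_mul ((contDiff_planeWave ξ t (n := 1)).differentiable one_ne_zero x)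
      (differentiable_evalReal (amplitude A a t i) x) i
    rw [partialDeriv_planeWave, partialDeriv_evalReal, evalReal_pderiv_amplitude,
      evalReal_amplitude] at this
    exact this
  have ht' : (t : ℂ) ≠ 0 := by exact_mod_cast ht
  have c0 := congrFun hcross 0
  have c1 := congrFun hcross 1
  have c2 := congrFun hcross 2
  simp only [cross_apply, Pi.smul_apply, smul_eq_mul, Matrix.cons_val] at c0 c1 c2
  simp only [divergence, h1, Fin.sum_univ_three, cross_apply, Matrix.cons_val]
  rw [Fin.sum_univ_three] at hdot
  field_simp
  linear_combination (Complex.I * t * planeWave ξ t x * ((1 - quad A x : ℝ) : ℂ)) * hdot +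
    (2 * Complex.I * planeWave ξ t x) * (conormal A x 0 * c0 + conormal A x 1 * c1 +
      conormal A x 2 * c2) - (2 * planeWave ξ t x * (conormal A x 0 * a 0 + conormal A x 1 * a 1 +
      conormal A x 2 * a 2)) * Complex.I_sq

/-- The potential `(κ / (i t)) (1 - quad A) exp (i t ξ · x)`. -/
def wavePotential (A : Fin 3 → ℝ) (ξ : R3) (κ : ℂ) (t : ℝ) (x : R3) : ℂ :=
  planeWave ξ t x * evalReal (MvPolynomial.C (κ / (Complex.I * t)) * (1 - quadPoly A)) x

theorem contDiff_wavePotential (A : Fin 3 → ℝ) (ξ : R3) (κ : ℂ) (t : ℝ) :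
    ContDiff ℝ ∞ (wavePotential A ξ κ t) :=
  (contDiff_planeWave ξ t).mul (contDiff_evalReal _)

/-- The coefficients of the remainder in the eigenvalue equation, up to the factor
`exp (i t ξ · x) / t`. -/
def waveRemainder (A : Fin 3 → ℝ) (Ω : R3) (a : Fin 3 → ℂ) (κ : ℂ) (r : ℝ) (i : Fin 3) (x : R3) :
    ℂ :=
  -2 * (Complex.I * ((fun i => (Ω i : ℂ)) ⨯₃ (conormal A x ⨯₃ a)) i -
    r * (conormal A x ⨯₃ a) i) - 2 * Complex.I * κ * conormal A x i

theorem continuous_waveRemainder (A : Fin 3 → ℝ) (Ω : R3) (a : Fin 3 → ℂ) (κ : ℂ) (r : ℝ)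
    (i : Fin 3) : Continuous (waveRemainder A Ω a κ r i) := by
  have h : ∀ j, Continuous fun x => conormal A x j := fun j =>
    Complex.continuous_ofReal.comp (continuous_const.mul (contDiff_coord (n := 1) j).continuous)
  have h0 := h 0
  have h1 := h 1
  have h2 := h 2
  unfold waveRemainder
  simp only [cross_apply]
  fin_cases i <;> simp <;> fun_prop

/-- The tangent wave satisfies the eigenvalue equation up to a gradient and a term of order
`1 / t`. -/
theorem tangentWave_eigen (A : Fin 3 → ℝ) {Ω ξ : R3} {a : Fin 3 → ℂ} {κ : ℂ} {r : ℝ}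
    (hκ : ∀ i, Complex.I * ((fun i => (Ω i : ℂ)) ⨯₃ a) i - r * a i = κ * ξ i)
    {t : ℝ} (ht : t ≠ 0) (x : R3) (i : Fin 3) :
    Complex.I * ((fun i => (Ω i : ℂ)) ⨯₃ fun j => tangentWave A ξ a t j x) i -
      r * tangentWave A ξ a t i x =
    partialDeriv i (wavePotential A ξ κ t) x +
      planeWave ξ t x * (waveRemainder A Ω a κ r i x / t) := by
  have ht' : (t : ℂ) ≠ 0 := by exact_mod_cast ht
  have hpot : partialDeriv i (wavePotential A ξ κ t) x =
      planeWave ξ t x * (κ / (Complex.I * t) * (-2 * conormal A x i)) +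
      Complex.I * t * ξ i * planeWave ξ t x *
        (κ / (Complex.I * t) * ((1 - quad A x : ℝ) : ℂ)) := by
    have := partialDeriv_mul ((contDiff_planeWave ξ t (n := 1)).differentiable one_ne_zero x)
      (differentiable_evalReal (MvPolynomial.C (κ / (Complex.I * t)) * (1 - quadPoly A)) x) i
    rw [partialDeriv_planeWave, partialDeriv_evalReal, MvPolynomial.pderiv_mul,
      MvPolynomial.pderiv_C, zero_mul, zero_add] at this
    have h1 : ∀ q, evalReal (MvPolynomial.C (κ / (Complex.I * t)) * q) x =
        κ / (Complex.I * t) * evalReal q x := fun q => by simp [evalReal]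
    rw [h1, h1, evalReal_pderiv_one_sub_quadPoly] at this
    have h2 : evalReal (1 - quadPoly A) x = ((1 - quad A x : ℝ) : ℂ) := by
      rw [Complex.ofReal_sub, ← evalReal_quadPoly]
      simp [evalReal]
    rw [h2] at this
    exact this
  have hcross : ((fun i => (Ω i : ℂ)) ⨯₃ fun j => tangentWave A ξ a t j x) i =
      planeWave ξ t x * (((1 - quad A x : ℝ) : ℂ) * ((fun i => (Ω i : ℂ)) ⨯₃ a) i -
        2 / t * ((fun i => (Ω i : ℂ)) ⨯₃ (conormal A x ⨯₃ a)) i) := by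
    have : (fun j => tangentWave A ξ a t j x) = planeWave ξ t x •
        (((1 - quad A x : ℝ) : ℂ) • a - (2 / t : ℂ) • (conormal A x ⨯₃ a)) := by
      funext j
      simp [tangentWave, evalReal_amplitude]
    rw [this, map_smul, map_sub, map_smul, map_smul]
    rfl
  have hI : Complex.I⁻¹ = -Complex.I := Complex.inv_I
  rw [hcross, hpot, tangentWave, evalReal_amplitude, waveRemainder]
  have h := hκ i
  simp only [div_eq_mul_inv, mul_inv, hI]
  have htt : (t : ℂ) * (t : ℂ)⁻¹ = 1 := mul_inv_cancel₀ ht'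
  linear_combination (planeWave ξ t x * ((1 - quad A x : ℝ) : ℂ)) * h +
    (planeWave ξ t x * ((1 - quad A x : ℝ) : ℂ) * κ * ξ i) *
      (Complex.I ^ 2 * htt + Complex.I_sq)

/-! ### The spectrum -/

section

variable {A : Fin 3 → ℝ} (hA : ∀ i, 0 < A i)

/-- The norm of `exp (i t ξ · x) W / t` is at most of order `1 / t`. -/
theorem exists_norm_wave_div_le {W : Fin 3 → R3 → ℂ} (hW : ∀ i, Continuous (W i)) :
    ∃ C : ℝ, ∀ (ξ : R3) (t : ℝ), 0 < t →
      ∀ hc : ∀ i, Continuous fun x => planeWave ξ t x * (W i x / t),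
        ‖fieldL2 hA (fun i x => planeWave ξ t x * (W i x / t)) hc‖ ≤ C / t := by
  obtain ⟨B, hB⟩ := (isCompact_ellipsoid hA).exists_bound_of_continuousOn
    (continuous_vecField hW).continuousOn
  have hB0 : 0 ≤ B := (norm_nonneg _).trans (hB 0 (by simp [mem_ellipsoid, quad]))
  refine ⟨(ellipsoidMeasure A).real Set.univ ^ (1 / 2 : ℝ) * B, fun ξ t ht hc => ?_⟩
  rw [mul_div_assoc]
  refine norm_fieldL2_le hA hc (by positivity) fun x hx => ?_
  have h1 : vecField (fun i x => planeWave ξ t x * (W i x / t)) x =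
      (planeWave ξ t x / t) • vecField W x := by
    ext i
    simp only [vecField, PiLp.smul_apply, smul_eq_mul]
    ring
  rw [h1, norm_smul, norm_div, norm_planeWave, Complex.norm_real, Real.norm_of_nonneg ht.le,
    one_div, inv_mul_eq_div]
  gcongr
  exact hB x hx

/-- The norm of the principal part `exp (i t ξ · x) (1 - quad A) a` of the wave does not depend
on `t`. -/
theorem exists_norm_wave_eq {a : Fin 3 → ℂ} (ha : a ≠ 0) :
    ∃ c : ℝ, 0 < c ∧ ∀ (ξ : R3) (t : ℝ),
      ∀ hc : ∀ i, Continuous fun x => planeWave ξ t x * (((1 - quad A x : ℝ) : ℂ) * a i),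
        ‖fieldL2 hA (fun i x => planeWave ξ t x * (((1 - quad A x : ℝ) : ℂ) * a i)) hc‖ = c := by
  set F : R3 → ℝ := fun x => (1 - quad A x) ^ 2 * ∑ i, Complex.normSq (a i) with hF
  have hF0 : ∀ x, 0 ≤ F x := fun x =>
    mul_nonneg (sq_nonneg _) (Finset.sum_nonneg fun i _ => Complex.normSq_nonneg _)
  have hpos : 0 < ∑ i, Complex.normSq (a i) := by
    obtain ⟨i, hi⟩ := Function.ne_iff.1 ha
    exact Finset.sum_pos' (fun i _ => Complex.normSq_nonneg _)
      ⟨i, Finset.mem_univ i, Complex.normSq_pos.2 hi⟩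
  have hint : 0 < ∫ x in ellipsoid A, F x := by
    refine lt_of_le_of_ne (integral_nonneg hF0) fun h => ?_
    have h0 := eq_zero_of_setIntegral_eq_zero hA (F := F)
      (((continuous_const.sub (continuous_quad A)).pow 2).mul continuous_const)
      (fun x _ => hF0 x) h.symm (x := 0) (by simp [quad])
    simp only [hF, quad] at h0
    simp at h0
    linarith
  refine ⟨√(∫ x in ellipsoid A, F x), Real.sqrt_pos.2 hint, fun ξ t hc => ?_⟩
  rw [← Real.sqrt_sq (norm_nonneg (fieldL2 hA _ hc))]
  congr 1
  have h1 : ((‖fieldL2 hA _ hc‖ ^ 2 : ℝ) : ℂ) = ((∫ x in ellipsoid A, F x : ℝ) : ℂ) := by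
    rw [← integral_complex_ofReal]
    have := inner_self_eq_norm_sq_to_K (𝕜 := ℂ) (fieldL2 hA _ hc)
    rw [inner_fieldL2] at this
    rw [Complex.ofReal_pow]
    refine this.symm.trans (integral_congr_ae (Filter.Eventually.of_forall fun x => ?_))
    have hu : conj (planeWave ξ t x) * planeWave ξ t x = 1 := by
      rw [← Complex.normSq_eq_conj_mul_self, Complex.normSq_eq_norm_sq, norm_planeWave]
      norm_num
    simp only [hF, map_mul, Complex.conj_ofReal, Complex.ofReal_mul, Complex.ofReal_pow,
      Complex.ofReal_sum, Complex.normSq_eq_conj_mul_self, Finset.mul_sum]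
    refine Finset.sum_congr rfl fun i _ => ?_
    linear_combination (((1 - quad A x : ℝ) : ℂ) ^ 2 * (conj (a i) * a i)) * hu
  exact_mod_cast h1

include hA in
/-- Each point of `[-‖Ω‖, ‖Ω‖]` has approximate eigenvectors, the tangent waves of high
frequency. -/
theorem mem_spectrum_poincareOp (Ω : R3) {r : ℝ} (hr : r ∈ Set.Icc (-‖Ω‖) ‖Ω‖) :
    (r : ℂ) ∈ spectrum ℂ (poincareOp A Ω) := by
  obtain ⟨ξ, a, κ, ha, hcross, hdot, hκ⟩ := exists_polarisation Ω hr
  obtain ⟨c, hc, hcw⟩ := exists_norm_wave_eq hA ha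
  obtain ⟨C₁, hC₁⟩ := exists_norm_wave_div_le hA (continuous_waveRemainder A Ω a κ r)
  obtain ⟨C₂, hC₂⟩ := exists_norm_wave_div_le hA (W := fun i x =>
    2 * evalReal (conormalCrossPoly A a i) x) fun i => continuous_const.mul (continuous_evalReal _)
  have hpw : ∀ t, Continuous (planeWave ξ t) := fun t =>
    (contDiff_planeWave ξ t (n := 1)).continuous
  set τ : ℕ → ℝ := fun n => n + 1 with hτ
  have hτ0 : ∀ n, 0 < τ n := fun n => by positivity
  have hτlim : ∀ C : ℝ, Filter.Tendsto (fun n => C / τ n) Filter.atTop (nhds 0) := fun C =>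
    (Filter.tendsto_atTop_add_const_right _ 1 tendsto_natCast_atTop_atTop).const_div_atTop C
  let v : ℕ → solenoidal A := fun n => ⟨_, fieldL2_mem_solenoidal hA
    (contDiff_tangentWave A ξ a (τ n)) (divergence_tangentWave A hcross hdot (hτ0 n).ne')
    fun _ hx => tangentWave_tangent A ξ a (τ n) hx⟩
  refine mem_spectrum_of_approx (v := v) (half_pos hc) ?_ ?_
  · -- the norm of the wave is at least `c - C₂ / t`
    filter_upwards [(hτlim C₂).eventually (gt_mem_nhds (half_pos hc))] with n hn
    have hc1 : ∀ i, Continuous fun x =>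
        planeWave ξ (τ n) x * (((1 - quad A x : ℝ) : ℂ) * a i) := fun i =>
      (hpw _).mul ((Complex.continuous_ofReal.comp
        (continuous_const.sub (continuous_quad A))).mul continuous_const)
    have hc2 : ∀ i, Continuous fun x =>
        planeWave ξ (τ n) x * (2 * evalReal (conormalCrossPoly A a i) x / τ n) := fun i =>
      (hpw _).mul ((continuous_const.mul (continuous_evalReal _)).div_const _)
    have hsum : (v n : L2Fields A) + fieldL2 hA _ hc2 = fieldL2 hA _ hc1 := by
      refine eq_fieldL2 hA hc1 ?_
      filter_upwards [Lp.coeFn_add (v n : L2Fields A) (fieldL2 hA _ hc2),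
        coeFn_fieldL2 hA fun i => (contDiff_tangentWave A ξ a (τ n) i).continuous,
        coeFn_fieldL2 hA hc2] with x h1 h2 h3
      rw [h1, Pi.add_apply, h2, h3]
      ext i
      simp only [vecField, PiLp.add_apply, tangentWave, evalReal_amplitude,
        evalReal_conormalCrossPoly]
      ring
    have h1 := norm_add_le (v n : L2Fields A) (fieldL2 hA _ hc2)
    rw [hsum, hcw] at h1
    have h2 := hC₂ ξ (τ n) (hτ0 n) hc2
    rw [Submodule.coe_norm]
    linarith
  · refine squeeze_zero_norm (fun n => ?_) (hτlim C₁)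
    have hcg := continuous_partialDeriv_of_smooth (contDiff_wavePotential A ξ κ (τ n))
    have hcr : ∀ i, Continuous fun x =>
        planeWave ξ (τ n) x * (waveRemainder A Ω a κ r i x / τ n) := fun i =>
      (hpw _).mul ((continuous_waveRemainder A Ω a κ r i).div_const _)
    have heq : Complex.I • crossOp A Ω (v n) - (r : ℂ) • (v n : L2Fields A) =
        fieldL2 hA _ hcg + fieldL2 hA _ hcr := by
      refine Lp.ext ?_
      filter_upwards [Lp.coeFn_sub (Complex.I • crossOp A Ω (v n)) ((r : ℂ) • (v n : L2Fields A)),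
        Lp.coeFn_smul Complex.I (crossOp A Ω (v n)), Lp.coeFn_smul (r : ℂ) (v n : L2Fields A),
        coeFn_crossOp A Ω (v n), Lp.coeFn_add (fieldL2 hA _ hcg) (fieldL2 hA _ hcr),
        coeFn_fieldL2 hA fun i => (contDiff_tangentWave A ξ a (τ n) i).continuous,
        coeFn_fieldL2 hA hcg, coeFn_fieldL2 hA hcr] with x h1 h2 h3 h4 h5 h6 h7 h8
      rw [h1, Pi.sub_apply, h2, h3, Pi.smul_apply, Pi.smul_apply, h4, h5, Pi.add_apply, h6, h7, h8]
      ext i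
      exact tangentWave_eigen A hκ (hτ0 n).ne' x i
    -- the projector kills the gradient and fixes the wave
    have hgrad : leray A (fieldL2 hA _ hcg) = 0 :=
      (solenoidal A).orthogonalProjectionOnto_apply_of_mem_orthogonal
        (Submodule.le_orthogonal_orthogonal _ (Submodule.subset_span
          (fieldL2_grad_mem hA (contDiff_wavePotential A ξ κ (τ n)))))
    have hfix : leray A (v n : L2Fields A) = v n :=
      (solenoidal A).orthogonalProjectionOnto_mem_subspace_eq_self (v n)
    have hres : poincareOp A Ω (v n) - (r : ℂ) • v n = leray A (fieldL2 hA _ hcr) := by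
      have := congrArg (leray A) heq
      rw [map_sub, map_add, hgrad, zero_add, map_smul, map_smul, hfix] at this
      rw [← this, poincareOp_apply]
    rw [hres]
    exact ((solenoidal A).norm_orthogonalProjectionOnto_apply_le _).trans
      (hC₁ ξ (τ n) (hτ0 n) hcr)

end

end Poincare

end

theorem theorem1 (A : Fin 3 → ℝ) (hA : ∀ i, 0 < A i) (Ω : Poincare.R3) :
    -- `𝒱ₙ⁰` consists of the polynomial fields of degree at most `n` that are divergence free
    -- and tangent to the boundary
    (∀ (n : ℕ) (u : Poincare.L2Fields A), u ∈ Poincare.polySolenoidal A n ↔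
      ∃ p : Fin 3 → MvPolynomial (Fin 3) ℂ, (∀ i, (p i).totalDegree ≤ n) ∧
        ⇑u =ᵐ[Poincare.ellipsoidMeasure A] Poincare.polyField p ∧
        Poincare.DivFree p ∧ Poincare.TangentToBoundary A p) ∧
    -- `𝒱ₙ⁰` is invariant by `P`
    (∀ (n : ℕ) (u : Poincare.solenoidal A),
      (u : Poincare.L2Fields A) ∈ Poincare.polySolenoidal A n →
      (Poincare.poincareOp A Ω u : Poincare.L2Fields A) ∈ Poincare.polySolenoidal A n) ∧
    -- the spectrum is the interval `[-ω, ω]`, and it is pure point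
    spectrum ℂ (Poincare.poincareOp A Ω) = Complex.ofReal '' Set.Icc (-‖Ω‖) ‖Ω‖ ∧
    Poincare.HasPurePointSpectrum (Poincare.poincareOp A Ω) ∧
    -- there is an orthonormal basis of `𝒱⁰` of eigenvectors with polynomial coefficients
    (∃ (ι : Type) (b : HilbertBasis ι ℂ (Poincare.solenoidal A)), ∀ i : ι,
      (∃ μ : ℂ, Module.End.HasEigenvector
        (Poincare.poincareOp A Ω : Poincare.solenoidal A →ₗ[ℂ] Poincare.solenoidal A) μ (b i)) ∧
      ∃ n : ℕ, (b i : Poincare.L2Fields A) ∈ Poincare.polyFields A n) := by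
  obtain ⟨ι, b, hb⟩ := Poincare.exists_poly_eigenbasis hA Ω
  refine ⟨fun n u => Poincare.mem_polySolenoidal_iff hA n u,
    fun n u hu => Poincare.poincareOp_mem_polySolenoidal hA Ω hu, ?_,
    Poincare.hasPurePointSpectrum_of_hilbertBasis b fun i => (hb i).1, ι, b, hb⟩
  refine (Poincare.spectrum_poincareOp_subset A Ω).antisymm ?_
  rintro _ ⟨r, hr, rfl⟩
  exact Poincare.mem_spectrum_poincareOp hA Ω hr
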